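/- **Theorem (Braverman compression).** Let $\mathcal X,\mathcal Y$ be finite sets and $\mu$ a probability distribution on $\mathcal X\times\mathcal Y$. Protocols are two-party protocols in which a fixed number $\|\pi\|$ of bits is exchanged one at a time (the previous bits determine the speaker), with public coins $R$ and private coins of each player, all independent of each other and of the inputs. The transcript $\Pi=\pi(x,y)$ consists of the public coins and all the bits exchanged. The internal information cost is $\mathsf{IC}_\mu(\pi)=I(\Pi;X\mid YR)+I(\Pi;Y\mid XR)$ for $(X,Y)\sim\mu$, in bits. A protocol $\tau$ *$\varepsilon$-simulates* $\pi$ under $\mu$ if there are functions $g_A,g_B$ such that, for $(X,Y)\sim\mu$, the joint law of $\bigl(X,\,Y,\,g_A(X,\tau(X,Y)),\,g_B(Y,\tau(X,Y))\bigr)$ is within total variation distance $\varepsilon$ of the law of $(X,Y,\Pi,\Pi)$; that is, both players reconstruct the same, approximately correctly distributed, transcript of $\pi$. There is an absolute constant $C>0$ such that for all $\mathcal X,\mathcal Y,\mu$, every protocol $\pi$, with $I:=\mathsf{IC}_\mu(\pi)$, and every $\varepsilon>0$, there is a protocol $\tau$ which $\varepsilon$-simulates $\pi$ under $\mu$ with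 $$\|\tau\|\le \bigl(\log_2(4+1/\varepsilon)\bigr)^{C}\cdot 2^{C I/\varepsilon},$$ and, if $I\ge 1$, also $$\|\tau\|\le 2^{C I/\varepsilon}.$$ In particular the communication of $\tau$ is $2^{O(I/\varepsilon)}$ for $I\ge 1$, independently of the communication $\|\pi\|$ of $\pi$. -/

import Mathlib

open MeasureTheory

noncomputable section

/-! Two-party communication protocols with public and private coins. -/

/-- The two players. -/
inductive Party where
  | alice
  | bob

/-- A two-party protocol on inputs from `X × Y`: exactly `length` bits are exchanged one at a time.
The sequence of bits sent so far is a node of the protocol tree. It determines whose turn it is, and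
the next bit is a function of the speaker's input, the speaker's private coins and the public coins.
All three coin sources are independent of each other and of the inputs. -/
structure Protocol (X : Type*) (Y : Type*) where
  /-- the number of bits exchanged, i.e. the (worst case) communication cost -/
  length : ℕ
  Pub : Type
  PrivA : Type
  PrivB : Type
  [measPub : MeasurableSpace Pub]
  [measPrivA : MeasurableSpace PrivA]
  [measPrivB : MeasurableSpace PrivB]
  /-- the law of the public coins -/
  pubLaw : Measure Pub
  /-- the law of Alice's private coins -/
  privALaw : Measure PrivA
  /-- the law of Bob's private coins -/
  privBLaw : Measure PrivB
  [probPub : IsProbabilityMeasure pubLaw]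
  [probPrivA : IsProbabilityMeasure privALaw]
  [probPrivB : IsProbabilityMeasure privBLaw]
  /-- who speaks after a given history -/
  owner : List Bool → Party
  /-- the bit sent by Alice when it is her turn -/
  msgA : List Bool → X → PrivA → Pub → Bool
  /-- the bit sent by Bob when it is his turn -/
  msgB : List Bool → Y → PrivB → Pub → Bool
  measurable_msgA : ∀ h x, Measurable fun p : PrivA × Pub => msgA h x p.1 p.2
  measurable_msgB : ∀ h y, Measurable fun p : PrivB × Pub => msgB h y p.1 p.2

namespace Protocol

attribute [instance] Protocol.measPub Protocol.measPrivA Protocol.measPrivB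
  Protocol.probPub Protocol.probPrivA Protocol.probPrivB

variable {X Y : Type*}

/-- The bit that is sent after the history `h`. -/
def nextBit (π : Protocol X Y) (x : X) (y : Y) (r : π.Pub) (a : π.PrivA) (b : π.PrivB)
    (h : List Bool) : Bool :=
  match π.owner h with
  | Party.alice => π.msgA h x a r
  | Party.bob => π.msgB h y b r

/-- The list of the first `n` bits of the execution, in the order in which they are sent. -/
def history (π : Protocol X Y) (x : X) (y : Y) (r : π.Pub) (a : π.PrivA) (b : π.PrivB) :
    ℕ → List Bool
  | 0 => []
  | n + 1 => π.history x y r a b n ++ [π.nextBit x y r a b (π.history x y r a b n)]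

/-- Strings of exchanged bits. -/
abbrev Messages (π : Protocol X Y) : Type := Fin π.length → Bool

/-- The bits exchanged in the execution of the protocol. -/
def messages (π : Protocol X Y) (x : X) (y : Y) (r : π.Pub) (a : π.PrivA) (b : π.PrivB) :
    π.Messages :=
  fun i => π.nextBit x y r a b (π.history x y r a b i)

/-- A transcript consists of the public coins together with all the bits exchanged. -/
abbrev Transcript (π : Protocol X Y) : Type := π.Pub × π.Messages

/-- The joint law of the inputs `(x, y) ∼ μ` and the coins `(r, a, b)`. -/
def fullLaw [MeasurableSpace X] [MeasurableSpace Y] (π : Protocol X Y) (μ : Measure (X × Y)) :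
    Measure ((X × Y) × π.Pub × π.PrivA × π.PrivB) :=
  μ.prod (π.pubLaw.prod (π.privALaw.prod π.privBLaw))

end Protocol

/-! Information theory for random variables with finitely many values (logarithms in base 2). -/

/-- The entropy of a probability mass function. -/
def entropy {α : Type*} [Fintype α] (p : α → ℝ) : ℝ :=
  ∑ a, p a * Real.logb 2 (1 / p a)

/-- The conditional entropy `H(A | B)`, where `p a b = Pr[A = a, B = b]`. -/
def condEntropy {α β : Type*} [Fintype α] [Fintype β] (p : α → β → ℝ) : ℝ :=
  ∑ b, (∑ a, p a b) * entropy fun a => p a b / ∑ a', p a' b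

/-- The conditional mutual information `I(A; B | C) = H(A | C) - H(A | B C)`, where
`p a b c = Pr[A = a, B = b, C = c]`. -/
def condMutualInfo {α β γ : Type*} [Fintype α] [Fintype β] [Fintype γ] (p : α → β → γ → ℝ) : ℝ :=
  condEntropy (fun a c => ∑ b, p a b c) - condEntropy (fun a (bc : β × γ) => p a bc.1 bc.2)

/-- The total variation distance of two probability measures. -/
def tvDist {Ω : Type*} [MeasurableSpace Ω] (P Q : Measure Ω) : ℝ :=
  ⨆ S : {S : Set Ω // MeasurableSet S}, |P.real S.1 - Q.real S.1|

namespace Protocol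

variable {X Y : Type*}

/-- The joint probability mass function of the messages and the inputs `(x, y) ∼ μ`, given that the
public coins are `r`; the probability is over the inputs and the private coins. -/
def jointPmf [MeasurableSpace X] [MeasurableSpace Y] (π : Protocol X Y) (μ : Measure (X × Y))
    (r : π.Pub) (m : π.Messages) (x : X) (y : Y) : ℝ :=
  μ.real {(x, y)} *
    (π.privALaw.prod π.privBLaw).real {ab | π.messages x y r ab.1 ab.2 = m}

/-- The internal information cost `I(Π; X | Y R) + I(Π; Y | X R)`: the information is conditioned on
the public coins `R`, so it is the average over `r ∼ R` of the information given `R = r`. -/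
def infoCost [Fintype X] [Fintype Y] [MeasurableSpace X] [MeasurableSpace Y]
    (π : Protocol X Y) (μ : Measure (X × Y)) : ℝ :=
  ∫ r, (condMutualInfo (fun m x y => π.jointPmf μ r m x y) +
    condMutualInfo (fun m y x => π.jointPmf μ r m x y)) ∂π.pubLaw

/-- `τ.Simulates μ ε π`: after running `τ` on inputs `(x, y) ∼ μ`, each player computes a transcript
of `π` from the player's own input and the transcript of `τ`, such that the quadruple consisting of
the inputs `x`, `y`, Alice's output and Bob's output is `ε`-close in total variation distance to
`(x, y, Π, Π)`, where `Π` is the transcript of an execution of `π` on `(x, y)`. -/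
def Simulates [MeasurableSpace X] [MeasurableSpace Y] (τ : Protocol X Y) (μ : Measure (X × Y))
    (ε : ℝ) (π : Protocol X Y) : Prop :=
  ∃ (gA : X → τ.Transcript → π.Transcript) (gB : Y → τ.Transcript → π.Transcript),
    (∀ x, Measurable (gA x)) ∧ (∀ y, Measurable (gB y)) ∧
    tvDist
      ((τ.fullLaw μ).map fun ω =>
        (ω.1.1, ω.1.2,
          gA ω.1.1 (ω.2.1, τ.messages ω.1.1 ω.1.2 ω.2.1 ω.2.2.1 ω.2.2.2),
          gB ω.1.2 (ω.2.1, τ.messages ω.1.1 ω.1.2 ω.2.1 ω.2.2.1 ω.2.2.2)))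
      ((π.fullLaw μ).map fun ω =>
        (ω.1.1, ω.1.2,
          ((ω.2.1, π.messages ω.1.1 ω.1.2 ω.2.1 ω.2.2.1 ω.2.2.2) : π.Transcript),
          ((ω.2.1, π.messages ω.1.1 ω.1.2 ω.2.1 ω.2.2.1 ω.2.2.2) : π.Transcript)))
      ≤ ε

end Protocol

end

noncomputable section

open ProbabilityTheory

/-! Fix the public coins. The messages of `π` equal `m` with probability `p m * q m`, where `p`
depends only on Alice's input and `q` only on Bob's. Bob estimates `p` by its conditional average
`p'` given his input, and Alice estimates `q` by `q'` likewise. The term `I(Π; X | Y R)` is the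
expectation of `log (p Π / p' Π)`, and `I(Π; Y | X R)` that of `log (q Π / q' Π)`. So, for large
`K`, the events `K * p' Π < p Π` and `K * q' Π < q Π` have total probability of order `I / log K`
(`log_sub_one_mul_integral_misestimateProb_le`), which is at most `ε / 4` for `K = 4 * 2 ^ (4 * I /
ε)`.

The simulation is rejection sampling with shared coins. The public coins supply uniform triples `(m,
a, b)`. Alice accepts if `a ≤ p m` and `b ≤ K * q' m`, Bob if `a ≤ K * p' m` and `b ≤ q m`. Without
misestimates, the samples accepted by both have `m` distributed as `p * q`. Each player accepts a
fraction at most `K / |U|` of the samples, where `U` is the set of message strings. Hence in a round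
of `|U|` samples the first sample accepted by anyone is accepted by both with probability at least
about `1 / (3 * K)`. The players repeat this for `R` rounds, of order `K * log (1 / ε)`, send
`k`-bit hashes of the index of their first accepted sample in each round, and output the label from
the first round in which the hashes match (`sampleSpaceLaw_real_agree_acceptSet_ge`). This costs `2
* R * k` bits, whatever the length of `π`.

The law of the output only has to be bounded below on every event, up to `ε`: for probability
measures this one-sided bound already controls the total variation distance
(`simulates_simultaneous`). -/

/-! ### First hits and hash collisions under product measures. -/

theorem pi_real_box {ι S : Type*} [Fintype ι] [MeasurableSpace S] (ν : Measure S)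
    [IsProbabilityMeasure ν] (s : ι → Set S) :
    (Measure.pi fun _ : ι => ν).real (Set.univ.pi s) = ∏ i, ν.real (s i) := by
  simp [measureReal_def, Measure.pi_pi, ENNReal.toReal_prod]

/-- The law of the first sample that hits `H`, on a subset `G` of `H`. -/
theorem pi_real_firstHit {S : Type*} [MeasurableSpace S] (ν : Measure S) [IsProbabilityMeasure ν]
    {G H : Set S} (hG : MeasurableSet G) (hH : MeasurableSet H) (hGH : G ⊆ H) (n : ℕ) :
    (Measure.pi fun _ : Fin n => ν).real {ω | ∃ i, ω i ∈ G ∧ ∀ j < i, ω j ∉ H} =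
      ν.real G * ∑ i ∈ Finset.range n, (1 - ν.real H) ^ i := by
  have hset : {ω : Fin n → S | ∃ i, ω i ∈ G ∧ ∀ j < i, ω j ∉ H} =
      ⋃ i : Fin n, Set.univ.pi fun j => if j < i then Hᶜ else if j = i then G else Set.univ := by
    ext ω
    simp only [Set.mem_ofPred_eq, Set.mem_iUnion, Set.mem_pi, Set.mem_univ, true_imp_iff]
    refine exists_congr fun i => ⟨fun h j => ?_, fun h => ⟨by simpa using h i, fun j hj => ?_⟩⟩
    · split_ifs with h1 h2
      · exact h.2 j h1
      · exact h2 ▸ h.1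
      · trivial
    · simpa [hj] using h j
  rw [hset, measureReal_iUnion_fintype]
  · rw [Finset.mul_sum, Finset.sum_range]
    refine Finset.sum_congr rfl fun i _ => ?_
    rw [pi_real_box]
    have : ∀ j : Fin n, ν.real (if j < i then Hᶜ else if j = i then G else Set.univ) =
        (if j < i then 1 - ν.real H else 1) * (if j = i then ν.real G else 1) := by
      intro j
      split_ifs with h1 h2
      · exact absurd h2 h1.ne
      · rw [probReal_compl_eq_one_sub hH, mul_one]
      · simp
      · simp
    rw [Finset.prod_congr rfl fun j _ => this j, Finset.prod_mul_distrib]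
    have h2 : (Finset.univ.filter fun j : Fin n => j < i) = Finset.Iio i := by ext; simp
    rw [Finset.prod_ite_eq' , ← Finset.prod_filter, h2]
    simp [mul_comm]
  · intro i i' hne
    rw [Function.onFun, Set.disjoint_left]
    have key : ∀ i i' : Fin n, i < i' → ∀ ω : Fin n → S,
        (ω ∈ Set.univ.pi fun j => if j < i then Hᶜ else if j = i then G else Set.univ) →
        (ω ∈ Set.univ.pi fun j => if j < i' then Hᶜ else if j = i' then G else Set.univ) →
        False := by
      intro i i' hlt ω h h'
      have h1 := h i trivial
      have h2 := h' i trivial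
      simp only [lt_irrefl, if_true, if_false, hlt] at h1 h2
      exact h2 (hGH h1)
    rcases lt_or_gt_of_ne hne with h | h
    · exact fun ω h1 h2 => key i i' h ω h1 h2
    · exact fun ω h1 h2 => key i' i h ω h2 h1
  · intro i
    refine MeasurableSet.univ_pi fun j => ?_
    split_ifs
    · exact hH.compl
    · exact hG
    · exact .univ

theorem uniformOn_univ_real_singleton {V : Type*} [Fintype V] [MeasurableSpace V]
    [MeasurableSingletonClass V] (v : V) :
    (uniformOn (Set.univ : Set V)).real {v} = (Fintype.card V : ℝ)⁻¹ := by
  rw [measureReal_def, uniformOn_univ, Measure.count_singleton]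
  simp

/-- A uniformly random hash function maps two given keys to the same value with probability
`1 / |V|`. -/
theorem pi_uniformOn_real_collision_le {D V : Type*} [Fintype D] [Fintype V] [Nonempty V]
    [MeasurableSpace V] [MeasurableSingletonClass V] {d d' : D} (hne : d ≠ d') :
    (Measure.pi fun _ : D => uniformOn (Set.univ : Set V)).real {h | h d = h d'} ≤
      (Fintype.card V : ℝ)⁻¹ := by
  classical
  have hset : {h : D → V | h d = h d'} =
      ⋃ v ∈ (Finset.univ : Finset V), Set.univ.pi fun e => if e ∈ ({d, d'} : Finset D) then {v}
        else Set.univ := by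
    ext h
    simp only [Set.mem_ofPred_eq, Finset.mem_univ, Set.iUnion_true, Set.mem_iUnion, Set.mem_pi,
      true_imp_iff, Set.mem_univ]
    constructor
    · intro e
      refine ⟨h d, fun i => ?_⟩
      split_ifs with hi
      · rcases Finset.mem_insert.1 hi with rfl | hi
        · rfl
        · rw [Finset.mem_singleton.1 hi]; exact e.symm
      · trivial
    · rintro ⟨v, hv⟩
      have h1 := hv d
      have h2 := hv d'
      simp at h1 h2
      rw [h1, h2]
  rw [hset]
  refine (measureReal_biUnion_finset_le _ _).trans ?_
  have : ∀ v : V, (Measure.pi fun _ : D => uniformOn (Set.univ : Set V)).real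
      (Set.univ.pi fun e => if e ∈ ({d, d'} : Finset D) then {v} else Set.univ) =
      (Fintype.card V : ℝ)⁻¹ ^ 2 := by
    intro v
    rw [pi_real_box]
    have : ∀ e : D, (uniformOn (Set.univ : Set V)).real
        (if e ∈ ({d, d'} : Finset D) then {v} else Set.univ) =
        if e ∈ ({d, d'} : Finset D) then (Fintype.card V : ℝ)⁻¹ else 1 := by
      intro e
      split_ifs
      · exact uniformOn_univ_real_singleton v
      · simp
    rw [Finset.prod_congr rfl fun e _ => this e, Finset.prod_ite_mem, Finset.univ_inter,
      Finset.prod_const, Finset.card_pair hne]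
  rw [Finset.sum_congr rfl fun v _ => this v]
  have : (Fintype.card V : ℝ) ≠ 0 := by simp
  simp only [Finset.sum_const, Finset.card_univ, nsmul_eq_mul]
  rw [sq, mul_inv_cancel_left₀ this]

/-! ### Rejection samples and their acceptance regions. -/

/-- A candidate transcript together with the two thresholds used for rejection sampling. -/
abbrev Sample (U : Type*) := U × unitInterval × unitInterval

/-- Candidates and thresholds are uniform and independent. -/
def sampleLaw (U : Type*) [MeasurableSpace U] : Measure (Sample U) :=
  (uniformOn (Set.univ : Set U)).prod (volume.prod volume)

instance (U : Type*) [MeasurableSpace U] [Finite U] [Nonempty U] :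
    IsProbabilityMeasure (sampleLaw U) := by
  unfold sampleLaw; infer_instance

/-- The samples that are below the given thresholds. -/
def acceptSet {U : Type*} (p q : U → ℝ) : Set (Sample U) :=
  {s | (s.2.1 : ℝ) ≤ p s.1 ∧ (s.2.2 : ℝ) ≤ q s.1}

theorem unitInterval_real_le {p : ℝ} (hp : 0 ≤ p) :
    (volume : Measure unitInterval).real {a | (a : ℝ) ≤ p} = min p 1 := by
  have : {a : unitInterval | (a : ℝ) ≤ p} =
      Set.Iic ⟨min p 1, le_min hp zero_le_one, min_le_right _ _⟩ := by
    ext a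
    simp [← Subtype.coe_le_coe, a.2.2]
  rw [this, measureReal_def, unitInterval.volume_Iic, ENNReal.toReal_ofReal]
  exact le_min hp zero_le_one

/-- The thresholds are capped at `1` because an estimate multiplied by `K` can exceed `1`. -/
theorem sampleLaw_real_acceptSet_inter {U : Type*} [Fintype U] [MeasurableSpace U]
    [MeasurableSingletonClass U] {p q : U → ℝ} (hp : ∀ m, 0 ≤ p m) (hq : ∀ m, 0 ≤ q m)
    (m : U) :
    (sampleLaw U).real (acceptSet p q ∩ {s | s.1 = m}) =
      min (p m) 1 * min (q m) 1 / Fintype.card U := by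
  have : acceptSet p q ∩ {s | s.1 = m} =
      {m} ×ˢ ({a : unitInterval | (a : ℝ) ≤ p m} ×ˢ {b : unitInterval | (b : ℝ) ≤ q m}) := by
    ext ⟨m', a, b⟩
    simp only [acceptSet, Set.mem_inter_iff, Set.mem_ofPred_eq, Set.mem_prod, Set.mem_singleton_iff]
    constructor
    · rintro ⟨h, rfl⟩; exact ⟨rfl, h⟩
    · rintro ⟨rfl, h⟩; exact ⟨h, rfl⟩
  rw [this, sampleLaw, measureReal_prod_prod, measureReal_prod_prod, uniformOn_univ_real_singleton,
    unitInterval_real_le (hp m), unitInterval_real_le (hq m)]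
  ring

theorem measurableSet_acceptSet {U : Type*} [Finite U] [MeasurableSpace U]
    [MeasurableSingletonClass U] (p q : U → ℝ) : MeasurableSet (acceptSet p q) := by
  have hp : Measurable p := measurable_of_finite p
  have hq : Measurable q := measurable_of_finite q
  have h1 : MeasurableSet {s : Sample U | (s.2.1 : ℝ) ≤ p s.1} :=
    measurableSet_le (by fun_prop) (hp.comp measurable_fst)
  have h2 : MeasurableSet {s : Sample U | (s.2.2 : ℝ) ≤ q s.1} :=
    measurableSet_le (by fun_prop) (hq.comp measurable_fst)
  exact h1.inter h2

theorem sampleLaw_real_acceptSet {U : Type*} [Fintype U] [MeasurableSpace U]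
    [MeasurableSingletonClass U] [Nonempty U] {p q : U → ℝ} (hp : ∀ m, 0 ≤ p m)
    (hq : ∀ m, 0 ≤ q m) :
    (sampleLaw U).real (acceptSet p q) =
      (∑ m, min (p m) 1 * min (q m) 1) / Fintype.card U := by
  have : acceptSet p q = ⋃ m : U, (acceptSet p q ∩ {s | s.1 = m}) := by
    ext s; simp
  rw [this, measureReal_iUnion_fintype, Finset.sum_div]
  · exact Finset.sum_congr rfl fun m _ => sampleLaw_real_acceptSet_inter hp hq m
  · intro m m' hne
    rw [Function.onFun, Set.disjoint_left]
    rintro s ⟨_, h⟩ ⟨_, h'⟩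
    exact hne (h.symm.trans h')
  · intro m
    exact (measurableSet_acceptSet p q).inter (measurable_fst (measurableSet_singleton m))

/-! ### Agreement of the players through hashed indices. -/

/-- The hash values of the first accepted sample of each round, where `b j i` tells whether the
`i`-th sample of round `j` is accepted. -/
def roundHashes {R N : ℕ} {V : Type*} (b : Fin R → Fin N → Bool) (h : Option (Fin N) → V) :
    Fin R → V :=
  fun j => h (Fin.find? (b j))

/-- The label of the first accepted sample of the first round in which a sample is accepted and its
hash value agrees with the other player's. -/
def agreedLabel {R N : ℕ} {V U : Type*} [DecidableEq V] [Inhabited U] (b : Fin R → Fin N → Bool)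
    (lab : Fin R → Fin N → U) (h : Option (Fin N) → V) (v : Fin R → V) : U :=
  -- Without the `isSome` guard, a round in which neither player accepts anything would count as a
  -- match, since `none` is hashed too.
  match Fin.find? fun j => (Fin.find? (b j)).isSome && decide (roundHashes b h j = v j) with
  | none => default
  | some j =>
    match Fin.find? (b j) with
    | none => default
    | some i => lab j i

/-- In the absence of collisions, equal hashes mean equal indices, so the first matching round is
the first one in which both players really select the same sample. -/
theorem agreedLabel_eq {R N : ℕ} {V U : Type*} [DecidableEq V] [Inhabited U]
    {a b : Fin R → Fin N → Bool} {lab : Fin R → Fin N → U} {h : Option (Fin N) → V}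
    (hcoll : ∀ j, h (Fin.find? (a j)) = h (Fin.find? (b j)) →
      Fin.find? (a j) = Fin.find? (b j))
    {j : Fin R} {i : Fin N} (ha : Fin.find? (a j) = some i) (hb : Fin.find? (b j) = some i)
    (hlt : ∀ j' < j, ∀ i', ¬ (Fin.find? (a j') = some i' ∧ Fin.find? (b j') = some i')) :
    agreedLabel a lab h (roundHashes b h) = lab j i := by
  have : Fin.find? (fun j => (Fin.find? (a j)).isSome &&
      decide (roundHashes a h j = roundHashes b h j)) = some j := by
    rw [Fin.find?_eq_some_iff]
    refine ⟨by simp [ha, hb, roundHashes], fun j' hj' => ?_⟩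
    by_contra hne
    rw [Bool.not_eq_false, Bool.and_eq_true, Option.isSome_iff_exists] at hne
    obtain ⟨⟨i', hi'⟩, heq⟩ := hne
    exact hlt j' hj' i' ⟨hi', (hcoll j' (of_decide_eq_true heq)) ▸ hi'⟩
  simp [agreedLabel, this, ha]

/-- The public randomness of the simulation: `R` rounds of `N` samples, and a hash function. -/
abbrev SampleSpace (U : Type) (R N k : ℕ) :=
  (Fin R → Fin N → Sample U) × (Option (Fin N) → Fin k → Bool)

/-- The law of the public randomness of the simulation. -/
def sampleSpaceLaw (U : Type) [MeasurableSpace U] (R N k : ℕ) : Measure (SampleSpace U R N k) :=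
  (Measure.pi fun _ => Measure.pi fun _ => sampleLaw U).prod
    (Measure.pi fun _ => uniformOn (Set.univ : Set (Fin k → Bool)))

instance (U : Type) [Finite U] [MeasurableSpace U] [Nonempty U] (R N k : ℕ) :
    IsProbabilityMeasure (sampleSpaceLaw U R N k) := by
  unfold sampleSpaceLaw; infer_instance

open Classical in
/-- The table of the samples that belong to `A`. -/
def acceptTable {U : Type} {R N : ℕ} (A : Set (Sample U)) (ρ : Fin R → Fin N → Sample U) :
    Fin R → Fin N → Bool :=
  fun j i => decide (ρ j i ∈ A)

theorem find?_acceptTable_eq_some {U : Type} {R N : ℕ} {A : Set (Sample U)}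
    {ρ : Fin R → Fin N → Sample U} {j : Fin R} {i : Fin N} :
    Fin.find? (acceptTable A ρ j) = some i ↔ ρ j i ∈ A ∧ ∀ i' < i, ρ j i' ∉ A := by
  simp [acceptTable]

theorem measurable_acceptTable {U : Type} [MeasurableSpace U] {R N : ℕ} {A : Set (Sample U)}
    (hA : MeasurableSet A) : Measurable (acceptTable (R := R) (N := N) A) := by
  refine measurable_pi_iff.2 fun j => measurable_pi_iff.2 fun i => ?_
  refine measurable_to_bool ?_
  have : (fun ρ : Fin R → Fin N → Sample U => acceptTable A ρ j i) ⁻¹' {true} =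
      (fun ρ => ρ j i) ⁻¹' A := by
    ext ρ; simp [acceptTable]
  rw [this]
  exact hA.preimage (by fun_prop)

/-- The hash function is independent of the samples. Once these are fixed, each round compares two
fixed keys, and a union bound over the rounds allows one hash function to serve them all. -/
theorem sampleSpaceLaw_real_collision_le {U : Type} [Finite U] [MeasurableSpace U] [Nonempty U]
    {R N k : ℕ} {A B : Set (Sample U)}
    (hA : MeasurableSet A) (hB : MeasurableSet B) :
    (sampleSpaceLaw U R N k).real {ω | ∃ j, Fin.find? (acceptTable A ω.1 j) ≠
      Fin.find? (acceptTable B ω.1 j) ∧ ω.2 (Fin.find? (acceptTable A ω.1 j)) =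
        ω.2 (Fin.find? (acceptTable B ω.1 j))} ≤ R * (2⁻¹ : ℝ) ^ k := by
  set E := {ω : SampleSpace U R N k | ∃ j, Fin.find? (acceptTable A ω.1 j) ≠
      Fin.find? (acceptTable B ω.1 j) ∧ ω.2 (Fin.find? (acceptTable A ω.1 j)) =
        ω.2 (Fin.find? (acceptTable B ω.1 j))} with hE
  have hmeas : MeasurableSet E := by
    have h1 : Measurable fun ω : SampleSpace U R N k =>
        (acceptTable A ω.1, acceptTable B ω.1, ω.2) :=
      ((measurable_acceptTable hA).comp measurable_fst).prodMk
        (((measurable_acceptTable hB).comp measurable_fst).prodMk measurable_snd)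
    exact h1 (MeasurableSet.of_discrete (s := {t : (Fin R → Fin N → Bool) × (Fin R → Fin N → Bool) ×
      (Option (Fin N) → Fin k → Bool) | ∃ j, Fin.find? (t.1 j) ≠ Fin.find? (t.2.1 j) ∧
        t.2.2 (Fin.find? (t.1 j)) = t.2.2 (Fin.find? (t.2.1 j))}))
  have hslice : ∀ ρ : Fin R → Fin N → Sample U,
      (Measure.pi fun _ : Option (Fin N) => uniformOn (Set.univ : Set (Fin k → Bool)))
        (Prod.mk ρ ⁻¹' E) ≤ ENNReal.ofReal (R * (2⁻¹ : ℝ) ^ k) := by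
    intro ρ
    rw [← ofReal_measureReal]
    refine ENNReal.ofReal_le_ofReal ?_
    have hsub : Prod.mk ρ ⁻¹' E ⊆ ⋃ j ∈ (Finset.univ : Finset (Fin R)),
        {h | Fin.find? (acceptTable A ρ j) ≠ Fin.find? (acceptTable B ρ j) ∧
          h (Fin.find? (acceptTable A ρ j)) = h (Fin.find? (acceptTable B ρ j))} := by
      rintro h ⟨j, hj⟩
      simp only [Finset.mem_univ, Set.iUnion_true, Set.mem_iUnion]
      exact ⟨j, hj⟩
    refine (measureReal_mono hsub (measure_ne_top _ _)).trans
      ((measureReal_biUnion_finset_le _ _).trans ?_)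
    refine (Finset.sum_le_card_nsmul _ _ ((2⁻¹ : ℝ) ^ k) fun j _ => ?_).trans (by simp)
    by_cases hne : Fin.find? (acceptTable A ρ j) = Fin.find? (acceptTable B ρ j)
    · simp [hne]
    · refine (measureReal_mono fun h hh => hh.2).trans
        ((pi_uniformOn_real_collision_le hne).trans ?_)
      simp
  rw [measureReal_def, sampleSpaceLaw, Measure.prod_apply hmeas]
  refine ENNReal.toReal_le_of_le_ofReal (by positivity) ?_
  refine (lintegral_mono hslice).trans ?_
  simp

/-- Simultaneous sampling: a transcript `m` is output by both players with probability at least its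
weight `∑ m ∈ W, g m`, up to the probability of a collision, where `g m` is the probability that a
sample with label `m` is accepted by both players. -/
theorem sampleSpaceLaw_real_agree_ge {U : Type} [Fintype U]
    [MeasurableSpace U] [Inhabited U] [MeasurableSingletonClass U] {R N k : ℕ}
    {A B : Set (Sample U)}
    (hA : MeasurableSet A) (hB : MeasurableSet B) (W : Finset U) (g : U → ℝ)
    (hg : ∀ m, (sampleLaw U).real (A ∩ B ∩ {s | s.1 = m}) = g m) (c : ℝ)
    (hc : c = ∑ i ∈ Finset.range N, (1 - (sampleLaw U).real (A ∪ B)) ^ i) :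
    (∑ m ∈ W, g m) * c * ∑ j ∈ Finset.range R, (1 - (∑ m, g m) * c) ^ j - R * (2⁻¹ : ℝ) ^ k ≤
      (sampleSpaceLaw U R N k).real {ω | ∃ m ∈ W,
        agreedLabel (acceptTable A ω.1) (fun j i => (ω.1 j i).1) ω.2
          (roundHashes (acceptTable B ω.1) ω.2) = m ∧
        agreedLabel (acceptTable B ω.1) (fun j i => (ω.1 j i).1) ω.2
          (roundHashes (acceptTable A ω.1) ω.2) = m} := by
  have hlab : ∀ m : U, MeasurableSet {s : Sample U | s.1 = m} := fun m =>
    measurable_fst (measurableSet_singleton m)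
  have hABW : ∀ W : Finset U, A ∩ B ∩ {s | s.1 ∈ W} = ⋃ m ∈ W, (A ∩ B ∩ {s | s.1 = m}) := by
    intro W; ext s; simp
  have hgW : ∀ W : Finset U, (sampleLaw U).real (A ∩ B ∩ {s | s.1 ∈ W}) = ∑ m ∈ W, g m := by
    intro W
    rw [hABW, measureReal_biUnion_finset]
    · exact Finset.sum_congr rfl fun m _ => hg m
    · intro m _ m' _ hne
      rw [Function.onFun, Set.disjoint_left]
      rintro s ⟨_, h⟩ ⟨_, h'⟩
      exact hne (h.symm.trans h')
    · exact fun m _ => (hA.inter hB).inter (hlab m)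
  have hWm : ∀ W : Finset U, MeasurableSet (A ∩ B ∩ {s | s.1 ∈ W}) := fun W =>
    (hA.inter hB).inter (measurable_fst W.measurableSet)
  -- one round
  let M : Finset U → Set (Fin N → Sample U) := fun W =>
    {ρ | ∃ i, ρ i ∈ A ∩ B ∩ {s | s.1 ∈ W} ∧ ∀ i' < i, ρ i' ∉ A ∪ B}
  have hM : ∀ W, (Measure.pi fun _ : Fin N => sampleLaw U).real (M W) = (∑ m ∈ W, g m) * c := by
    intro W
    rw [hc, ← hgW W]
    exact pi_real_firstHit _ (hWm W) (hA.union hB) (fun s hs => Or.inl hs.1.1) N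
  have hMm : ∀ W, MeasurableSet (M W) := by
    intro W
    have : M W = ⋃ i : Fin N, ((fun ρ => ρ i) ⁻¹' (A ∩ B ∩ {s | s.1 ∈ W}) ∩
        ⋂ i' : Fin N, ⋂ _ : i' < i, (fun ρ => ρ i') ⁻¹' (A ∪ B)ᶜ) := by
      ext ρ; simp [M]
    rw [this]
    refine .iUnion fun i => .inter ((hWm W).preimage (measurable_pi_apply i)) ?_
    exact .iInter fun i' => .iInter fun _ => (hA.union hB).compl.preimage (measurable_pi_apply i')
  have hMsub : M W ⊆ M Finset.univ := by
    rintro ρ ⟨i, h, h'⟩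
    exact ⟨i, ⟨h.1, Finset.mem_univ _⟩, h'⟩
  -- The first-hit formula is used on two levels: `hM` applies it to the samples of a round, and
  -- here it is applied to the rounds, a hit being a round whose first sample in `A ∪ B` lies in `A
  -- ∩ B`.
  have hall := pi_real_firstHit (Measure.pi fun _ : Fin N => sampleLaw U) (hMm W)
    (hMm Finset.univ) hMsub R
  rw [hM, hM] at hall
  rw [← hall]
  have hprod : (Measure.pi fun _ : Fin R => Measure.pi fun _ : Fin N => sampleLaw U).real
      {ρ | ∃ j, ρ j ∈ M W ∧ ∀ j' < j, ρ j' ∉ M Finset.univ} =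
      (sampleSpaceLaw U R N k).real
        ({ρ | ∃ j, ρ j ∈ M W ∧ ∀ j' < j, ρ j' ∉ M Finset.univ} ×ˢ Set.univ) := by
    rw [sampleSpaceLaw, measureReal_prod_prod]; simp
  rw [hprod]
  refine (sub_le_sub_left
    (sampleSpaceLaw_real_collision_le (R := R) (N := N) (k := k) hA hB) _).trans ?_
  refine (le_measureReal_sdiff).trans (measureReal_mono ?_)
  rintro ⟨ρ, h⟩ ⟨⟨⟨j, ⟨i, ⟨⟨hiA, hiB⟩, hiW⟩, hi⟩, hj⟩, -⟩, hcoll⟩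
  have hcoll' : ∀ j, h (Fin.find? (acceptTable A ρ j)) = h (Fin.find? (acceptTable B ρ j)) →
      Fin.find? (acceptTable A ρ j) = Fin.find? (acceptTable B ρ j) := by
    intro j hj
    by_contra hne
    exact hcoll ⟨j, hne, hj⟩
  have hfA : Fin.find? (acceptTable A ρ j) = some i :=
    find?_acceptTable_eq_some.2 ⟨hiA, fun i' hi' h' => hi i' hi' (Or.inl h')⟩
  have hfB : Fin.find? (acceptTable B ρ j) = some i :=
    find?_acceptTable_eq_some.2 ⟨hiB, fun i' hi' h' => hi i' hi' (Or.inr h')⟩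
  -- An earlier round with a common selection would itself be a hit, contrary to the choice of `j`.
  have hlt : ∀ j' < j, ∀ i', ¬ (Fin.find? (acceptTable A ρ j') = some i' ∧
      Fin.find? (acceptTable B ρ j') = some i') := by
    rintro j' hj' i' ⟨h1, h2⟩
    rw [find?_acceptTable_eq_some] at h1 h2
    refine hj j' hj' ⟨i', ⟨⟨h1.1, h2.1⟩, Finset.mem_univ _⟩, fun i'' hi'' => ?_⟩
    rintro (h' | h')
    · exact h1.2 i'' hi'' h'
    · exact h2.2 i'' hi'' h'
  refine ⟨(ρ j i).1, hiW, ?_, ?_⟩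
  · exact agreedLabel_eq hcoll' hfA hfB hlt
  · exact agreedLabel_eq (fun j hj => (hcoll' j hj.symm).symm) hfB hfA
      fun j' hj' i' hh => hlt j' hj' i' hh.symm

/-! ### Quantitative bounds for the public-coin sampling protocol. -/

/-- A lower bound for `(1 - (1 - u) ^ n) / u` that remains meaningful at `u = 0`. The induction uses
that the sums satisfy `s (n + 1) = (1 - u) * s n + 1`. -/
theorem div_one_add_mul_le_geom_sum {u : ℝ} (hu0 : 0 ≤ u) (hu1 : u ≤ 1) (n : ℕ) :
    n / (1 + n * u) ≤ ∑ i ∈ Finset.range n, (1 - u) ^ i := by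
  induction n with
  | zero => simp
  | succ n ih =>
    have h1 : ∑ i ∈ Finset.range (n + 1), (1 - u) ^ i =
        (1 - u) * ∑ i ∈ Finset.range n, (1 - u) ^ i + 1 := by
      rw [Finset.sum_range_succ', Finset.mul_sum]
      simp [pow_succ']
    have hn : (0 : ℝ) < 1 + n * u := by positivity
    rw [h1]
    refine le_trans ?_ (add_le_add_left (mul_le_mul_of_nonneg_left ih (sub_nonneg.2 hu1)) 1)
    push_cast
    have : (1 - u) * (n / (1 + n * u)) + 1 = (n + 1) / (1 + n * u) := by
      field_simp; ring
    rw [this]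
    gcongr
    linarith

theorem mul_geom_sum_one_sub (x : ℝ) (n : ℕ) :
    x * ∑ i ∈ Finset.range n, (1 - x) ^ i = 1 - (1 - x) ^ n := by
  have := mul_neg_geom_sum (1 - x) n
  rwa [sub_sub_cancel] at this

/-- Repeating a round that succeeds with probability `G * c` and then has an outcome in a given set
with weight `GW * c`. -/
theorem repeated_rounds_ge {DW GW G c : ℝ} (R : ℕ) (hGW : 0 ≤ GW) (hG : GW ≤ G) (hG1 : G ≤ 1)
    (hGc : G * c ≤ 1) (hD : DW - GW ≤ 1 - G) :
    DW - (2 * (1 - G) + Real.exp (-(c * R))) ≤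
      GW * c * ∑ j ∈ Finset.range R, (1 - G * c) ^ j := by
  set s := ∑ j ∈ Finset.range R, (1 - G * c) ^ j with hs
  have hgeom : G * c * s = 1 - (1 - G * c) ^ R := mul_geom_sum_one_sub _ _
  have hG0 : 0 ≤ G := hGW.trans hG
  -- Convexity of `exp` between `0` and `-(c * R)` moves `G` out of the exponent, so that no lower
  -- bound on `G` is needed.
  have hexp : (1 - G * c) ^ R ≤ (1 - G) + Real.exp (-(c * R)) := by
    calc (1 - G * c) ^ R ≤ Real.exp (-(G * c)) ^ R := by
          refine pow_le_pow_left₀ (by linarith) ?_ _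
          linarith [Real.add_one_le_exp (-(G * c))]
      _ = Real.exp ((1 - G) • 0 + G • (-(c * R))) := by
          rw [← Real.exp_nat_mul]; congr 1; simp; ring
      _ ≤ (1 - G) • Real.exp 0 + G • Real.exp (-(c * R)) :=
          convexOn_exp.2 trivial trivial (by linarith) hG0 (by ring)
      _ ≤ (1 - G) + Real.exp (-(c * R)) := by
          simp only [Real.exp_zero, smul_eq_mul, mul_one]
          have := mul_le_of_le_one_left (Real.exp_pos (-(c * R))).le hG1
          linarith
  have hpow : 0 ≤ (1 - G * c) ^ R := pow_nonneg (by linarith) _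
  rcases le_total 1 (c * s) with h | h
  · have := mul_le_mul_of_nonneg_left h hGW
    have h2 := (Real.exp_pos (-(c * R))).le
    nlinarith
  · have := mul_le_mul_of_nonneg_right hG (sub_nonneg.2 h)
    nlinarith

/-- The public-coin sampling protocol: if Alice knows `p` and an estimate `q'` of `q`, and Bob knows
`q` and an estimate `p'` of `p`, then their outputs agree and are distributed according to `p * q`,
up to a one-sided error. -/
theorem sampleSpaceLaw_real_agree_acceptSet_ge {U : Type} [Fintype U] [MeasurableSpace U]
    [Inhabited U] [MeasurableSingletonClass U] {p q p' q' : U → ℝ} {K : ℝ} (hK : 1 ≤ K)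
    (hp : ∀ m, 0 ≤ p m) (hp1 : ∀ m, p m ≤ 1) (hq : ∀ m, 0 ≤ q m) (hq1 : ∀ m, q m ≤ 1)
    (hp' : ∀ m, 0 ≤ p' m) (hq' : ∀ m, 0 ≤ q' m) (hpq : ∑ m, p m * q m = 1)
    (hpq' : ∑ m, p m * q' m ≤ 1) (hp'q : ∑ m, p' m * q m ≤ 1) (R k : ℕ) (W : Finset U)
    {A B : Set (Sample U)} (hA : A = acceptSet p fun m => K * q' m)
    (hB : B = acceptSet (fun m => K * p' m) q) :
    ∑ m ∈ W, p m * q m - (2 * (∑ m, (if K * p' m < p m then p m * q m else 0) +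
        ∑ m, (if K * q' m < q m then p m * q m else 0)) +
        Real.exp (-(R / (3 * K))) + R * (2⁻¹ : ℝ) ^ k) ≤
      (sampleSpaceLaw U R (Fintype.card U) k).real {ω | ∃ m ∈ W,
        agreedLabel (acceptTable A ω.1) (fun j i => (ω.1 j i).1) ω.2
          (roundHashes (acceptTable B ω.1) ω.2) = m ∧
        agreedLabel (acceptTable B ω.1) (fun j i => (ω.1 j i).1) ω.2
          (roundHashes (acceptTable A ω.1) ω.2) = m} := by
  -- With `|U|` samples per round, the expected number of samples accepted by some player is at most
  -- `2 * K`.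
  set N := Fintype.card U with hN
  have hN0 : (0 : ℝ) < N := by exact_mod_cast Fintype.card_pos
  have hK0 : 0 ≤ K := zero_le_one.trans hK
  have hKp' : ∀ m, 0 ≤ K * p' m := fun m => mul_nonneg hK0 (hp' m)
  have hKq' : ∀ m, 0 ≤ K * q' m := fun m => mul_nonneg hK0 (hq' m)
  have hAm : MeasurableSet A := hA ▸ measurableSet_acceptSet _ _
  have hBm : MeasurableSet B := hB ▸ measurableSet_acceptSet _ _
  -- The density of `A ∩ B`, scaled by `N`; it equals `p m * q m` wherever neither estimate is too
  -- small by a factor `K`.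
  let γ : U → ℝ := fun m => min (p m) (K * p' m) * min (q m) (K * q' m)
  have hγ0 : ∀ m, 0 ≤ γ m := fun m =>
    mul_nonneg (le_min (hp m) (hKp' m)) (le_min (hq m) (hKq' m))
  have hγ1 : ∀ m, γ m ≤ p m * q m := fun m =>
    mul_le_mul (min_le_left _ _) (min_le_left _ _) (le_min (hq m) (hKq' m)) (hp m)
  have hAB : A ∩ B = acceptSet (fun m => min (p m) (K * p' m)) fun m => min (q m) (K * q' m) := by
    subst hA hB
    ext s
    simp only [acceptSet, Set.mem_inter_iff, Set.mem_ofPred_eq, le_min_iff]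
    tauto
  have hABm : ∀ m, (sampleLaw U).real (A ∩ B ∩ {s | s.1 = m}) = γ m / N := by
    intro m
    rw [hAB, sampleLaw_real_acceptSet_inter (fun m => le_min (hp m) (hKp' m))
      (fun m => le_min (hq m) (hKq' m)), min_eq_left ((min_le_left _ _).trans (hp1 m)),
      min_eq_left ((min_le_left _ _).trans (hq1 m))]
  have hABr : (sampleLaw U).real (A ∩ B) = (∑ m, γ m) / N := by
    rw [hAB, sampleLaw_real_acceptSet (fun m => le_min (hp m) (hKp' m))
      (fun m => le_min (hq m) (hKq' m))]
    congr 1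
    refine Finset.sum_congr rfl fun m _ => ?_
    rw [min_eq_left ((min_le_left _ _).trans (hp1 m)),
      min_eq_left ((min_le_left _ _).trans (hq1 m))]
  have hAr : (sampleLaw U).real A ≤ K / N := by
    rw [hA, sampleLaw_real_acceptSet hp hKq']
    gcongr
    calc ∑ m, min (p m) 1 * min (K * q' m) 1 ≤ ∑ m, K * (p m * q' m) := by
          refine Finset.sum_le_sum fun m _ => ?_
          calc _ ≤ p m * (K * q' m) := mul_le_mul (min_le_left _ _) (min_le_left _ _)
                (le_min (hKq' m) zero_le_one) (hp m)
            _ = _ := by ring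
      _ = K * ∑ m, p m * q' m := by rw [Finset.mul_sum]
      _ ≤ K := mul_le_of_le_one_right hK0 hpq'
  have hBr : (sampleLaw U).real B ≤ K / N := by
    rw [hB, sampleLaw_real_acceptSet hKp' hq]
    gcongr
    calc ∑ m, min (K * p' m) 1 * min (q m) 1 ≤ ∑ m, K * (p' m * q m) := by
          refine Finset.sum_le_sum fun m _ => ?_
          calc _ ≤ (K * p' m) * q m := mul_le_mul (min_le_left _ _) (min_le_left _ _)
                (le_min (hq m) zero_le_one) (hKp' m)
            _ = _ := by ring
      _ = K * ∑ m, p' m * q m := by rw [Finset.mul_sum]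
      _ ≤ K := mul_le_of_le_one_right hK0 hp'q
  set u := (sampleLaw U).real (A ∪ B) with hu
  have hu0 : 0 ≤ u := measureReal_nonneg
  have hu1 : u ≤ 1 := measureReal_le_one
  have huK : N * u ≤ 2 * K := by
    have h1 : u ≤ K / N + K / N := (measureReal_union_le A B).trans (add_le_add hAr hBr)
    calc N * u ≤ N * (K / N + K / N) := by gcongr
      _ = 2 * K := by field_simp; ring
  set c := ∑ i ∈ Finset.range N, (1 - u) ^ i with hc
  have hc0 : 0 ≤ c := Finset.sum_nonneg fun i _ => pow_nonneg (by linarith) _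
  -- Here `1 + N * u ≤ 1 + 2 * K ≤ 3 * K`, the last step because `1 ≤ K`.
  have hcK : 1 / (3 * K) ≤ c / N := by
    have h1 := div_one_add_mul_le_geom_sum hu0 hu1 N
    have h2 : (N : ℝ) / (3 * K) ≤ N / (1 + N * u) := by
      gcongr; linarith
    rw [le_div_iff₀ hN0]
    calc 1 / (3 * K) * N = N / (3 * K) := by ring
      _ ≤ c := h2.trans h1
  have hGc : (∑ m, γ m) * (c / N) ≤ 1 := by
    have h1 : (∑ m, γ m) / N ≤ u := by
      rw [← hABr]
      exact measureReal_mono fun s hs => Or.inl hs.1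
    calc (∑ m, γ m) * (c / N) = (∑ m, γ m) / N * c := by ring
      _ ≤ u * c := by gcongr
      _ = 1 - (1 - u) ^ N := mul_geom_sum_one_sub u N
      _ ≤ 1 := by linarith [pow_nonneg (sub_nonneg.2 hu1) N]
  have hmain := sampleSpaceLaw_real_agree_ge (R := R) (k := k) hAm hBm W
    (fun m => γ m / N) hABm c hc
  have hG1 : ∑ m, γ m ≤ 1 := hpq ▸ Finset.sum_le_sum fun m _ => hγ1 m
  have hDW : ∑ m ∈ W, p m * q m - ∑ m ∈ W, γ m ≤ 1 - ∑ m, γ m := by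
    rw [← hpq, ← Finset.sum_sub_distrib, ← Finset.sum_sub_distrib]
    exact Finset.sum_le_sum_of_subset_of_nonneg (Finset.subset_univ _)
      fun m _ _ => sub_nonneg.2 (hγ1 m)
  have hrep := repeated_rounds_ge R (Finset.sum_nonneg fun m (_ : m ∈ W) => hγ0 m)
    (Finset.sum_le_sum_of_subset_of_nonneg (Finset.subset_univ W) fun m _ _ => hγ0 m) hG1
    hGc hDW
  have hbad : 1 - ∑ m, γ m ≤ ∑ m, (if K * p' m < p m then p m * q m else 0) +
        ∑ m, (if K * q' m < q m then p m * q m else 0) := by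
    rw [← hpq, ← Finset.sum_sub_distrib, ← Finset.sum_add_distrib]
    refine Finset.sum_le_sum fun m _ => ?_
    have h0 := mul_nonneg (hp m) (hq m)
    have := hγ0 m
    split_ifs with h1 h2 h2
    · linarith
    · linarith
    · linarith
    · simp only [γ, min_eq_left (not_lt.1 h1), min_eq_left (not_lt.1 h2)]
      simp
  have hexp : Real.exp (-(c / N * R)) ≤ Real.exp (-(R / (3 * K))) := by
    refine Real.exp_le_exp.2 (neg_le_neg ?_)
    calc R / (3 * K) = 1 / (3 * K) * R := by ring
      _ ≤ c / N * R := by gcongr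
  refine le_trans ?_ hmain
  have e1 : (∑ m ∈ W, γ m / N) * c = (∑ m ∈ W, γ m) * (c / N) := by
    rw [← Finset.sum_div]; ring
  have e2 : (∑ m, γ m / N) * c = (∑ m, γ m) * (c / N) := by
    rw [← Finset.sum_div]; ring
  rw [e1, e2]
  linarith

/-! Executions of a protocol. -/

namespace Protocol

variable {X Y : Type*} (π : Protocol X Y)

/-- The first `i` bits of a string of messages. -/
def pref (m : π.Messages) (i : ℕ) : List Bool := (List.ofFn m).take i

theorem pref_succ (m : π.Messages) (i : Fin π.length) :
    π.pref m (i + 1) = π.pref m i ++ [m i] := by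
  simp [pref, List.take_add_one]

theorem length_history (x : X) (y : Y) (r : π.Pub) (a : π.PrivA) (b : π.PrivB) (n : ℕ) :
    (π.history x y r a b n).length = n := by
  induction n with
  | zero => rfl
  | succ n ih => simp [history, ih]

/-- Replacing the actual history by prefixes of the fixed string `m` turns the event into separate
conditions on the single bits, each involving only its speaker. -/
theorem messages_eq_iff (x : X) (y : Y) (r : π.Pub) (a : π.PrivA) (b : π.PrivB)
    (m : π.Messages) :
    π.messages x y r a b = m ↔ ∀ i : Fin π.length, π.nextBit x y r a b (π.pref m i) = m i := by
  constructor
  · rintro h i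
    have hist : ∀ n ≤ π.length, π.history x y r a b n = π.pref m n := by
      intro n hn
      induction n with
      | zero => rfl
      | succ n ih =>
        rw [π.pref_succ m ⟨n, hn⟩, history, ih (by omega), ← h]
        simp only [messages]
        rw [ih (by omega), h]
    rw [← hist i i.2.le]
    exact congrFun h i
  · intro h
    have hist : ∀ n ≤ π.length, π.history x y r a b n = π.pref m n := by
      intro n hn
      induction n with
      | zero => rfl
      | succ n ih =>
        rw [π.pref_succ m ⟨n, hn⟩, history, ih (by omega), h ⟨n, hn⟩]
    funext i
    rw [messages, hist i i.2.le, h]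

/-- The private coins for which Alice's bits are consistent with `m`. -/
def aliceSet (m : π.Messages) (x : X) (r : π.Pub) : Set π.PrivA :=
  {a | ∀ i : Fin π.length, π.owner (π.pref m i) = Party.alice → π.msgA (π.pref m i) x a r = m i}

/-- The private coins for which Bob's bits are consistent with `m`. -/
def bobSet (m : π.Messages) (y : Y) (r : π.Pub) : Set π.PrivB :=
  {b | ∀ i : Fin π.length, π.owner (π.pref m i) = Party.bob → π.msgB (π.pref m i) y b r = m i}

/-- The probability that Alice's bits are consistent with `m`. -/
def aliceProb (x : X) (r : π.Pub) (m : π.Messages) : ℝ := π.privALaw.real (π.aliceSet m x r)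

/-- The probability that Bob's bits are consistent with `m`. -/
def bobProb (y : Y) (r : π.Pub) (m : π.Messages) : ℝ := π.privBLaw.real (π.bobSet m y r)

/-- The rectangle property of protocols: it is the source of the factorization into `aliceProb` and
`bobProb`. -/
theorem setOf_messages_eq (x : X) (y : Y) (r : π.Pub) (m : π.Messages) :
    {ab : π.PrivA × π.PrivB | π.messages x y r ab.1 ab.2 = m} =
      π.aliceSet m x r ×ˢ π.bobSet m y r := by
  ext ⟨a, b⟩
  simp only [Set.mem_ofPred_eq, messages_eq_iff, Set.mem_prod, aliceSet, bobSet, ← forall_and]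
  refine forall_congr' fun i => ?_
  unfold nextBit
  cases π.owner (π.pref m i) <;> simp

theorem real_messages_eq (x : X) (y : Y) (r : π.Pub) (m : π.Messages) :
    (π.privALaw.prod π.privBLaw).real {ab | π.messages x y r ab.1 ab.2 = m} =
      π.aliceProb x r m * π.bobProb y r m := by
  rw [setOf_messages_eq, measureReal_prod_prod]; rfl

theorem measurableSet_aliceSet (m : π.Messages) (x : X) :
    MeasurableSet {p : π.PrivA × π.Pub | p.1 ∈ π.aliceSet m x p.2} := by
  have : {p : π.PrivA × π.Pub | p.1 ∈ π.aliceSet m x p.2} =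
      ⋂ i : Fin π.length, ⋂ _ : π.owner (π.pref m i) = Party.alice,
        (fun p => π.msgA (π.pref m i) x p.1 p.2) ⁻¹' {m i} := by
    ext p; simp [aliceSet]
  rw [this]
  exact .iInter fun i => .iInter fun _ => π.measurable_msgA _ _ (measurableSet_singleton _)

theorem measurableSet_bobSet (m : π.Messages) (y : Y) :
    MeasurableSet {p : π.PrivB × π.Pub | p.1 ∈ π.bobSet m y p.2} := by
  have : {p : π.PrivB × π.Pub | p.1 ∈ π.bobSet m y p.2} =
      ⋂ i : Fin π.length, ⋂ _ : π.owner (π.pref m i) = Party.bob,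
        (fun p => π.msgB (π.pref m i) y p.1 p.2) ⁻¹' {m i} := by
    ext p; simp [bobSet]
  rw [this]
  exact .iInter fun i => .iInter fun _ => π.measurable_msgB _ _ (measurableSet_singleton _)

theorem measurable_aliceProb (x : X) (m : π.Messages) :
    Measurable fun r => π.aliceProb x r m :=
  (measurable_measure_prodMk_right (π.measurableSet_aliceSet m x)).ennreal_toReal

theorem measurable_bobProb (y : Y) (m : π.Messages) :
    Measurable fun r => π.bobProb y r m :=
  (measurable_measure_prodMk_right (π.measurableSet_bobSet m y)).ennreal_toReal

theorem measurable_messages (x : X) (y : Y) :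
    Measurable fun c : π.Pub × π.PrivA × π.PrivB => π.messages x y c.1 c.2.1 c.2.2 := by
  refine measurable_to_countable' fun m => ?_
  have : (fun c : π.Pub × π.PrivA × π.PrivB => π.messages x y c.1 c.2.1 c.2.2) ⁻¹' {m} =
      (fun c => (c.2.1, c.1)) ⁻¹' {p : π.PrivA × π.Pub | p.1 ∈ π.aliceSet m x p.2} ∩
      (fun c => (c.2.2, c.1)) ⁻¹' {p : π.PrivB × π.Pub | p.1 ∈ π.bobSet m y p.2} := by
    ext ⟨r, a, b⟩
    have := Set.ext_iff.1 (π.setOf_messages_eq x y r m) (a, b)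
    simpa using this
  rw [this]
  refine .inter ((π.measurableSet_aliceSet m x).preimage ?_)
    ((π.measurableSet_bobSet m y).preimage ?_) <;> fun_prop

theorem aliceProb_nonneg (x : X) (r : π.Pub) (m : π.Messages) : 0 ≤ π.aliceProb x r m :=
  measureReal_nonneg

theorem bobProb_nonneg (y : Y) (r : π.Pub) (m : π.Messages) : 0 ≤ π.bobProb y r m :=
  measureReal_nonneg

theorem aliceProb_le_one (x : X) (r : π.Pub) (m : π.Messages) : π.aliceProb x r m ≤ 1 :=
  measureReal_le_one

theorem bobProb_le_one (y : Y) (r : π.Pub) (m : π.Messages) : π.bobProb y r m ≤ 1 :=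
  measureReal_le_one

theorem real_messages_mem (x : X) (y : Y) (r : π.Pub) (W : Finset π.Messages) :
    (π.privALaw.prod π.privBLaw).real {ab | π.messages x y r ab.1 ab.2 ∈ W} =
      ∑ m ∈ W, π.aliceProb x r m * π.bobProb y r m := by
  have : {ab : π.PrivA × π.PrivB | π.messages x y r ab.1 ab.2 ∈ W} =
      ⋃ m ∈ W, {ab | π.messages x y r ab.1 ab.2 = m} := by
    ext ab; simp
  rw [this, measureReal_biUnion_finset]
  · exact Finset.sum_congr rfl fun m _ => π.real_messages_eq x y r m
  · intro m _ m' _ hne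
    rw [Function.onFun, Set.disjoint_left]
    intro ab h h'
    exact hne (h.symm.trans h')
  · intro m _
    exact ((π.measurable_messages x y).comp measurable_prodMk_left) (measurableSet_singleton m)

theorem sum_aliceProb_mul_bobProb (x : X) (y : Y) (r : π.Pub) :
    ∑ m, π.aliceProb x r m * π.bobProb y r m = 1 := by
  rw [← real_messages_mem]; simp

end Protocol

/-! Simultaneous message protocols with public coins. -/

namespace Protocol

variable {X Y : Type*} {P ι : Type} [MeasurableSpace P] [Fintype ι]

/-- The protocol in which Alice sends `fA x r` and Bob sends `fB y r`, where `r` are the public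
coins. -/
def simultaneous (ν : Measure P) [IsProbabilityMeasure ν] (fA : X → P → ι → Bool)
    (fB : Y → P → ι → Bool) (hA : ∀ x, Measurable (fA x)) (hB : ∀ y, Measurable (fB y)) :
    Protocol X Y where
  length := Fintype.card ι + Fintype.card ι
  Pub := P
  PrivA := Unit
  PrivB := Unit
  pubLaw := ν
  privALaw := Measure.dirac ()
  privBLaw := Measure.dirac ()
  owner h := if h.length < Fintype.card ι then Party.alice else Party.bob
  msgA h x _ r :=
    if hlt : h.length < Fintype.card ι then fA x r ((Fintype.equivFin ι).symm ⟨_, hlt⟩) else false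
  msgB h y _ r :=
    if hlt : h.length - Fintype.card ι < Fintype.card ι then
      fB y r ((Fintype.equivFin ι).symm ⟨_, hlt⟩) else false
  measurable_msgA h x := by
    split_ifs with hlt
    · exact (measurable_pi_apply _).comp ((hA x).comp measurable_snd)
    · exact measurable_const
  measurable_msgB h y := by
    split_ifs with hlt
    · exact (measurable_pi_apply _).comp ((hB y).comp measurable_snd)
    · exact measurable_const

variable {ν : Measure P} [IsProbabilityMeasure ν] {fA : X → P → ι → Bool}
    {fB : Y → P → ι → Bool} {hA : ∀ x, Measurable (fA x)} {hB : ∀ y, Measurable (fB y)}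

variable (ι) in
/-- Alice's part of the messages. -/
def leftHalf (t : Fin (Fintype.card ι + Fintype.card ι) → Bool) : ι → Bool :=
  fun i => t (Fin.castAdd _ (Fintype.equivFin ι i))

variable (ι) in
/-- Bob's part of the messages. -/
def rightHalf (t : Fin (Fintype.card ι + Fintype.card ι) → Bool) : ι → Bool :=
  fun i => t (Fin.natAdd _ (Fintype.equivFin ι i))

theorem leftHalf_messages (x : X) (y : Y) (r : P) (a b : Unit) :
    leftHalf ι ((simultaneous ν fA fB hA hB).messages x y r a b) = fA x r := by
  funext i
  simp only [leftHalf, messages, nextBit]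
  have hl := length_history (simultaneous ν fA fB hA hB) x y r a b (Fintype.equivFin ι i)
  simp only [simultaneous] at hl ⊢
  simp [hl]

theorem rightHalf_messages (x : X) (y : Y) (r : P) (a b : Unit) :
    rightHalf ι ((simultaneous ν fA fB hA hB).messages x y r a b) = fB y r := by
  funext i
  simp only [rightHalf, messages, nextBit]
  have hl := length_history (simultaneous ν fA fB hA hB) x y r a b
    (Fintype.equivFin ι i + Fintype.card ι)
  simp only [simultaneous] at hl ⊢
  simp [hl]

end Protocol

/-! ### From agreement probabilities to simulation in total variation. -/

theorem measureReal_prod_eq_integral {α β : Type*} [MeasurableSpace α] [MeasurableSpace β]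
    (μ : Measure α) (ν : Measure β) [IsProbabilityMeasure μ] [IsProbabilityMeasure ν]
    {E : Set (α × β)} (hE : MeasurableSet E) :
    (μ.prod ν).real E = ∫ a, ν.real (Prod.mk a ⁻¹' E) ∂μ := by
  rw [measureReal_def, Measure.prod_apply hE]
  exact (integral_toReal (measurable_measure_prodMk_left hE).aemeasurable
    (.of_forall fun a => measure_lt_top _ _)).symm

theorem integrable_measureReal_prodMk {α β : Type*} [MeasurableSpace α] [MeasurableSpace β]
    (μ : Measure α) (ν : Measure β) [IsProbabilityMeasure μ] [IsProbabilityMeasure ν]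
    {E : Set (α × β)} (hE : MeasurableSet E) :
    Integrable (fun a => ν.real (Prod.mk a ⁻¹' E)) μ := by
  refine Integrable.of_bound
    (measurable_measure_prodMk_left hE).ennreal_toReal.aestronglyMeasurable 1
    (.of_forall fun a => ?_)
  rw [Real.norm_of_nonneg measureReal_nonneg]
  exact measureReal_le_one

/-- Passing to complements turns the one-sided bound into the other one. -/
theorem tvDist_le_of_forall_sub_le {Ω : Type*} [MeasurableSpace Ω] {P Q : Measure Ω}
    [IsProbabilityMeasure P] [IsProbabilityMeasure Q] {ε : ℝ}
    (h : ∀ S, MeasurableSet S → Q.real S - P.real S ≤ ε) : tvDist P Q ≤ ε := by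
  have : Nonempty {S : Set Ω // MeasurableSet S} := ⟨⟨∅, .empty⟩⟩
  refine ciSup_le fun S => abs_sub_le_iff.2 ⟨?_, h S.1 S.2⟩
  have := h _ S.2.compl
  rw [probReal_compl_eq_one_sub S.2, probReal_compl_eq_one_sub S.2] at this
  linarith

namespace Protocol

variable {X Y : Type*} [Fintype X] [Fintype Y] [MeasurableSpace X] [MeasurableSpace Y]
  [MeasurableSingletonClass X] [MeasurableSingletonClass Y]

instance (π : Protocol X Y) (μ : Measure (X × Y)) [IsProbabilityMeasure μ] :
    IsProbabilityMeasure (π.fullLaw μ) := by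
  unfold fullLaw; infer_instance

theorem fullLaw_real (π : Protocol X Y) (μ : Measure (X × Y)) [IsProbabilityMeasure μ]
    {E : Set ((X × Y) × π.Pub × π.PrivA × π.PrivB)} (hE : MeasurableSet E) :
    (π.fullLaw μ).real E = ∑ z, μ.real {z} *
      ∫ r, (π.privALaw.prod π.privBLaw).real {ab | (z, r, ab) ∈ E} ∂π.pubLaw := by
  rw [fullLaw, measureReal_prod_eq_integral _ _ hE, integral_fintype .of_finite]
  refine Finset.sum_congr rfl fun z _ => ?_
  rw [measureReal_prod_eq_integral _ _ (measurable_prodMk_left hE)]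
  rfl

/-- A criterion for a public-coin simultaneous message protocol to simulate `π`, in terms of the
probability that both players output the same transcript. -/
theorem simulates_simultaneous (π : Protocol X Y) (μ : Measure (X × Y)) [IsProbabilityMeasure μ]
    {Ω ι : Type} [MeasurableSpace Ω] [Fintype ι] (ν : Measure Ω) [IsProbabilityMeasure ν]
    {fA : X → π.Pub × Ω → ι → Bool} {fB : Y → π.Pub × Ω → ι → Bool}
    (hfA : ∀ x, Measurable (fA x)) (hfB : ∀ y, Measurable (fB y))
    {oA : X → (π.Pub × Ω) × (ι → Bool) → π.Messages}
    {oB : Y → (π.Pub × Ω) × (ι → Bool) → π.Messages}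
    (hoA : ∀ x, Measurable (oA x)) (hoB : ∀ y, Measurable (oB y))
    {δ : X → Y → π.Pub → ℝ} (hδ : ∀ x y, Integrable (δ x y) π.pubLaw)
    {ε : ℝ} (hε : ∑ z : X × Y, μ.real {z} * ∫ r, δ z.1 z.2 r ∂π.pubLaw ≤ ε)
    (h : ∀ x y r (W : Finset π.Messages),
      (π.privALaw.prod π.privBLaw).real {ab | π.messages x y r ab.1 ab.2 ∈ W} - δ x y r ≤
        ν.real {ω | ∃ m ∈ W, oA x ((r, ω), fB y (r, ω)) = m ∧ oB y ((r, ω), fA x (r, ω)) = m}) :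
    (simultaneous (π.pubLaw.prod ν) fA fB hfA hfB).Simulates μ ε π := by
  set τ := simultaneous (π.pubLaw.prod ν) fA fB hfA hfB with hτ
  -- Each player reads only the other's half of the messages and keeps the public coins of `π`,
  -- which are part of those of `τ`.
  let gA : X → τ.Transcript → π.Transcript := fun x t => (t.1.1, oA x (t.1, rightHalf ι t.2))
  let gB : Y → τ.Transcript → π.Transcript := fun y t => (t.1.1, oB y (t.1, leftHalf ι t.2))
  have hgA : ∀ x, Measurable (gA x) := fun x => by
    have h1 : Measurable fun t : τ.Transcript => ((t.1 : π.Pub × Ω), rightHalf ι t.2) :=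
      measurable_fst.prodMk ((measurable_of_finite (rightHalf ι)).comp measurable_snd)
    exact (measurable_fst.comp measurable_fst).prodMk ((hoA x).comp h1)
  have hgB : ∀ y, Measurable (gB y) := fun y => by
    have h1 : Measurable fun t : τ.Transcript => ((t.1 : π.Pub × Ω), leftHalf ι t.2) :=
      measurable_fst.prodMk ((measurable_of_finite (leftHalf ι)).comp measurable_snd)
    exact (measurable_fst.comp measurable_fst).prodMk ((hoB y).comp h1)
  refine ⟨gA, gB, hgA, hgB, ?_⟩
  have hF : Measurable fun ω : (X × Y) × τ.Pub × τ.PrivA × τ.PrivB => (ω.1.1, ω.1.2,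
      gA ω.1.1 (ω.2.1, τ.messages ω.1.1 ω.1.2 ω.2.1 ω.2.2.1 ω.2.2.2),
      gB ω.1.2 (ω.2.1, τ.messages ω.1.1 ω.1.2 ω.2.1 ω.2.2.1 ω.2.2.2)) := by
    refine measurable_from_prod_countable_right fun z => ?_
    have h1 : Measurable fun c : τ.Pub × τ.PrivA × τ.PrivB =>
        ((c.1, τ.messages z.1 z.2 c.1 c.2.1 c.2.2) : τ.Transcript) :=
      measurable_fst.prodMk (τ.measurable_messages z.1 z.2)
    exact (measurable_const (a := z.1)).prodMk ((measurable_const (a := z.2)).prodMk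
      (((hgA z.1).comp h1).prodMk ((hgB z.2).comp h1)))
  have hG : Measurable fun ω : (X × Y) × π.Pub × π.PrivA × π.PrivB => (ω.1.1, ω.1.2,
      ((ω.2.1, π.messages ω.1.1 ω.1.2 ω.2.1 ω.2.2.1 ω.2.2.2) : π.Transcript),
      ((ω.2.1, π.messages ω.1.1 ω.1.2 ω.2.1 ω.2.2.1 ω.2.2.2) : π.Transcript)) := by
    refine measurable_from_prod_countable_right fun z => ?_
    have h1 : Measurable fun c : π.Pub × π.PrivA × π.PrivB =>
        ((c.1, π.messages z.1 z.2 c.1 c.2.1 c.2.2) : π.Transcript) :=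
      measurable_fst.prodMk (π.measurable_messages z.1 z.2)
    exact (measurable_const (a := z.1)).prodMk ((measurable_const (a := z.2)).prodMk (h1.prodMk h1))
  have := Measure.isProbabilityMeasure_map (μ := τ.fullLaw μ) hF.aemeasurable
  have := Measure.isProbabilityMeasure_map (μ := π.fullLaw μ) hG.aemeasurable
  refine tvDist_le_of_forall_sub_le fun S hS => ?_
  rw [map_measureReal_apply hF hS, map_measureReal_apply hG hS, π.fullLaw_real μ (hG hS),
    τ.fullLaw_real μ (hF hS), ← Finset.sum_sub_distrib]
  refine le_trans (Finset.sum_le_sum fun z _ => ?_) hε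
  rw [← mul_sub]
  refine mul_le_mul_of_nonneg_left ?_ measureReal_nonneg
  obtain ⟨x, y⟩ := z
  -- the event of the simulation, for the inputs `x` and `y`
  let T : Set (π.Pub × Ω) := {c | (x, y, ((c.1, oA x (c, fB y c)) : π.Transcript),
    ((c.1, oB y (c, fA x c)) : π.Transcript)) ∈ S}
  have hT : MeasurableSet T := by
    have h1 : Measurable fun c : π.Pub × Ω => (x, y, ((c.1, oA x (c, fB y c)) : π.Transcript),
        ((c.1, oB y (c, fA x c)) : π.Transcript)) :=
      measurable_const.prodMk (measurable_const.prodMk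
        ((measurable_fst.prodMk ((hoA x).comp (measurable_id.prodMk (hfB y)))).prodMk
          (measurable_fst.prodMk ((hoB y).comp (measurable_id.prodMk (hfA x))))))
    exact h1 hS
  have hτint : ∫ c, (τ.privALaw.prod τ.privBLaw).real {ab | ((x, y), c, ab) ∈
      (fun ω : (X × Y) × τ.Pub × τ.PrivA × τ.PrivB => (ω.1.1, ω.1.2,
      gA ω.1.1 (ω.2.1, τ.messages ω.1.1 ω.1.2 ω.2.1 ω.2.2.1 ω.2.2.2),
      gB ω.1.2 (ω.2.1, τ.messages ω.1.1 ω.1.2 ω.2.1 ω.2.2.1 ω.2.2.2))) ⁻¹' S} ∂τ.pubLaw =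
      ∫ r, ν.real (Prod.mk r ⁻¹' T) ∂π.pubLaw := by
    rw [← measureReal_prod_eq_integral _ _ hT, ← integral_indicator_one hT]
    refine integral_congr_ae (.of_forall fun c => ?_)
    have h1 : ∀ ab : τ.PrivA × τ.PrivB, (gA x (c, τ.messages x y c ab.1 ab.2),
        gB y (c, τ.messages x y c ab.1 ab.2)) =
        (((c.1, oA x (c, fB y c)) : π.Transcript), ((c.1, oB y (c, fA x c)) : π.Transcript)) := by
      intro ab
      have e1 : rightHalf ι (τ.messages x y c ab.1 ab.2) = fB y c := rightHalf_messages ..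
      have e2 : leftHalf ι (τ.messages x y c ab.1 ab.2) = fA x c := leftHalf_messages ..
      simp only [gA, gB, e1, e2]
    have h2 : {ab : τ.PrivA × τ.PrivB | ((x, y), c, ab) ∈
      (fun ω : (X × Y) × τ.Pub × τ.PrivA × τ.PrivB => (ω.1.1, ω.1.2,
      gA ω.1.1 (ω.2.1, τ.messages ω.1.1 ω.1.2 ω.2.1 ω.2.2.1 ω.2.2.2),
      gB ω.1.2 (ω.2.1, τ.messages ω.1.1 ω.1.2 ω.2.1 ω.2.2.1 ω.2.2.2))) ⁻¹' S} =
        {_ab | c ∈ T} := by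
      ext ab
      change (x, y, (gA x (c, τ.messages x y c ab.1 ab.2),
        gB y (c, τ.messages x y c ab.1 ab.2))) ∈ S ↔ _
      rw [h1]; rfl
    beta_reduce
    rw [h2]
    by_cases hc : c ∈ T
    · have e := Set.indicator_of_mem hc (1 : π.Pub × Ω → ℝ)
      simp only [hc]
      exact probReal_univ.trans e.symm
    · have e := Set.indicator_of_notMem hc (1 : π.Pub × Ω → ℝ)
      simp only [hc]
      exact measureReal_empty.trans e.symm
  rw [hτint, sub_le_iff_le_add, ← integral_add (hδ x y) (integrable_measureReal_prodMk _ _ hT)]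
  have hGz : Measurable fun c : π.Pub × π.PrivA × π.PrivB => ((x, y), c) := measurable_prodMk_left
  refine integral_mono (integrable_measureReal_prodMk _ _ (hGz (hG hS)))
    ((hδ x y).add (integrable_measureReal_prodMk _ _ hT)) fun r => ?_
  classical
  rw [← sub_le_iff_le_add']
  -- The hypothesis `h` is applied to the strings `m` for which outputting `(r, m)` on both sides
  -- lands in `S`.
  refine le_trans (sub_le_sub_right (le_of_eq ?_) _) ((h x y r
    (Finset.univ.filter fun m => (x, y, ((r, m) : π.Transcript), ((r, m) : π.Transcript)) ∈ S)).trans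
    (measureReal_mono ?_))
  · congr 1
    ext ab
    simp
  · rintro ω ⟨m, hm, h1, h2⟩
    rw [Finset.mem_filter] at hm
    change (x, y, ((r, oA x ((r, ω), fB y (r, ω))) : π.Transcript),
      ((r, oB y ((r, ω), fA x (r, ω))) : π.Transcript)) ∈ S
    rw [h1, h2]
    exact hm.2

end Protocol

/-! Bounds for the conditional mutual information. -/

theorem condEntropy_eq_sum {α β : Type*} [Fintype α] [Fintype β] {p : α → β → ℝ}
    (hp : ∀ a b, 0 ≤ p a b) :
    condEntropy p = ∑ b, ∑ a, p a b * Real.logb 2 ((∑ a', p a' b) / p a b) := by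
  unfold condEntropy entropy
  refine Finset.sum_congr rfl fun b _ => ?_
  rw [Finset.mul_sum]
  refine Finset.sum_congr rfl fun a _ => ?_
  rcases eq_or_ne (∑ a', p a' b) 0 with h | h
  · have := (Finset.sum_eq_zero_iff_of_nonneg fun a' _ => hp a' b).1 h a (Finset.mem_univ a)
    simp [this]
  · rw [one_div_div, ← mul_assoc, mul_div_cancel₀ _ h]

theorem mul_logb_div_nonneg {p s : ℝ} (hp : 0 ≤ p) (hs : p ≤ s) :
    0 ≤ p * Real.logb 2 (s / p) := by
  rcases hp.eq_or_lt with rfl | h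
  · simp
  · exact mul_nonneg hp (Real.logb_nonneg one_lt_two ((one_le_div h).2 hs))

/-- This serves integrability over the public coins: the product stays bounded although the
logarithm blows up as `p` tends to `0`. -/
theorem mul_logb_div_le {p s : ℝ} (hp : 0 ≤ p) (hs : p ≤ s) :
    p * Real.logb 2 (s / p) ≤ s / Real.log 2 := by
  have h2 := Real.log_pos one_lt_two
  rcases hp.eq_or_lt with rfl | h
  · simpa using div_nonneg hs h2.le
  · rw [Real.logb, mul_div_assoc']
    gcongr
    have := Real.log_le_sub_one_of_pos (div_pos (h.trans_le hs) h)
    calc p * Real.log (s / p) ≤ p * (s / p - 1) := by gcongr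
      _ = s - p := by field_simp
      _ ≤ s := by linarith

theorem integrable_condEntropy {Ω α β : Type*} [Fintype α] [Fintype β] [MeasurableSpace Ω]
    (ν : Measure Ω) [IsFiniteMeasure ν] {p : Ω → α → β → ℝ}
    (hm : ∀ a b, Measurable fun r => p r a b) (hp : ∀ r a b, 0 ≤ p r a b) {C : ℝ}
    (hC : ∀ r a b, p r a b ≤ C) : Integrable (fun r => condEntropy (p r)) ν := by
  simp_rw [fun r => condEntropy_eq_sum (hp r)]
  refine integrable_finsetSum _ fun b _ => integrable_finsetSum _ fun a _ => ?_
  refine Integrable.of_bound (C := (Fintype.card α * C) / Real.log 2) ?_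
    (.of_forall fun r => ?_)
  · have h1 : Measurable fun r => ∑ a', p r a' b := Finset.measurable_sum _ fun a' _ => hm a' b
    exact ((hm a b).mul (((h1.div (hm a b)).log).div_const _)).aestronglyMeasurable
  · have h1 : p r a b ≤ ∑ a', p r a' b :=
      Finset.single_le_sum (f := fun a' => p r a' b) (fun a' _ => hp r a' b) (Finset.mem_univ a)
    rw [Real.norm_of_nonneg (mul_logb_div_nonneg (hp r a b) h1)]
    refine (mul_logb_div_le (hp r a b) h1).trans ?_
    have := (Real.log_pos one_lt_two).le
    gcongr
    simpa using Finset.sum_le_card_nsmul Finset.univ (fun a' => p r a' b) C fun a' _ => hC r a' b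

theorem integrable_condMutualInfo {Ω α β γ : Type*} [Fintype α] [Fintype β] [Fintype γ]
    [MeasurableSpace Ω] (ν : Measure Ω) [IsFiniteMeasure ν] {p : Ω → α → β → γ → ℝ}
    (hm : ∀ a b c, Measurable fun r => p r a b c) (hp : ∀ r a b c, 0 ≤ p r a b c) {C : ℝ}
    (hC : ∀ r a b c, p r a b c ≤ C) : Integrable (fun r => condMutualInfo (p r)) ν := by
  refine Integrable.sub (integrable_condEntropy ν (fun a c => ?_)
    (fun r a c => Finset.sum_nonneg fun b _ => hp r a b c) (C := Fintype.card β * C) fun r a c => ?_)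
    (integrable_condEntropy ν (fun a bc => hm a bc.1 bc.2) (fun r a bc => hp r a bc.1 bc.2)
      fun r a bc => hC r a bc.1 bc.2)
  · exact Finset.measurable_sum _ fun b _ => hm a b c
  · simpa using Finset.sum_le_card_nsmul Finset.univ (fun b => p r a b c) C fun b _ => hC r a b c

/-- With `ρ = s * t / (p * w)`, the right side is `-p * log ρ`. In general `-log ρ ≥ 1 - ρ`, and if
`K * ρ < 1` then even `-log ρ > log K`. The term `p - s * t / w` has a nonnegative sum, so the
negative part of the information density needs no separate treatment. -/
theorem mul_log_div_sub_log_div_ge {p s t w K : ℝ} (hp : 0 ≤ p) (hs : p ≤ s) (ht : p ≤ t)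
    (hw : s ≤ w) (hK : 0 < K) :
    p - s * t / w + (Real.log K - 1) * (if K * (s * t) < p * w then p else 0) ≤
      p * (Real.log (w / s) - Real.log (t / p)) := by
  rcases hp.eq_or_lt with rfl | h
  · have h1 : 0 ≤ s * t / w := div_nonneg (mul_nonneg hs ht) (hs.trans hw)
    simp [h1]
  · have hs0 := h.trans_le hs
    have ht0 := h.trans_le ht
    have hw0 := hs0.trans_le hw
    set ρ := s * t / (p * w) with hρ
    have hρ0 : 0 < ρ := by positivity
    have hlog : Real.log (w / s) - Real.log (t / p) = -Real.log ρ := by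
      rw [hρ, Real.log_div hw0.ne' hs0.ne', Real.log_div ht0.ne' h.ne',
        Real.log_div (by positivity) (by positivity), Real.log_mul hs0.ne' ht0.ne',
        Real.log_mul h.ne' hw0.ne']
      ring
    have e : p - s * t / w = p * (1 - ρ) := by rw [hρ]; field_simp
    rw [hlog, e]
    split_ifs with hlt
    · have h1 : K * ρ < 1 := by
        rw [hρ, mul_div_assoc', div_lt_one (by positivity)]; exact hlt
      have h2 : Real.log K + Real.log ρ < 0 := by
        rw [← Real.log_mul hK.ne' hρ0.ne']; exact Real.log_neg (by positivity) h1
      nlinarith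
    · have h1 := Real.log_le_sub_one_of_pos hρ0
      nlinarith

/-- Large values of the information density have small probability if the conditional mutual
information is small. -/
theorem log_sub_one_mul_le_condMutualInfo {α β γ : Type*} [Fintype α] [Fintype β] [Fintype γ]
    {p : α → β → γ → ℝ} (hp : ∀ a b c, 0 ≤ p a b c) {K : ℝ} (hK : 0 < K) :
    (Real.log K - 1) * ∑ c, ∑ a, ∑ b,
      (if K * ((∑ b', p a b' c) * ∑ a', p a' b c) < p a b c * ∑ a', ∑ b', p a' b' c
        then p a b c else 0) ≤ condMutualInfo p * Real.log 2 := by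
  have h2 : Real.log 2 ≠ 0 := (Real.log_pos one_lt_two).ne'
  have hinfo : condMutualInfo p * Real.log 2 = ∑ c, ∑ a, ∑ b, p a b c *
      (Real.log ((∑ a', ∑ b', p a' b' c) / ∑ b', p a b' c) -
        Real.log ((∑ a', p a' b c) / p a b c)) := by
    rw [condMutualInfo, condEntropy_eq_sum fun a c => Finset.sum_nonneg fun b _ => hp a b c,
      condEntropy_eq_sum fun a (bc : β × γ) => hp a bc.1 bc.2, Fintype.sum_prod_type_right,
      ← Finset.sum_sub_distrib, Finset.sum_mul]
    refine Finset.sum_congr rfl fun c _ => ?_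
    rw [Finset.sum_comm (f := fun b a => p a b c * _), ← Finset.sum_sub_distrib, Finset.sum_mul]
    refine Finset.sum_congr rfl fun a _ => ?_
    rw [Finset.sum_mul, ← Finset.sum_sub_distrib, Finset.sum_mul]
    refine Finset.sum_congr rfl fun b _ => ?_
    simp only [Real.logb]
    field_simp
  -- For each `c`, both `p` and `s * t / w` have total mass `w`; only an inequality is needed, which
  -- also covers `w = 0`.
  have hzero : 0 ≤ ∑ c, ∑ a, ∑ b, (p a b c -
      (∑ b', p a b' c) * (∑ a', p a' b c) / ∑ a', ∑ b', p a' b' c) := by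
    refine Finset.sum_nonneg fun c _ => ?_
    simp_rw [Finset.sum_sub_distrib, ← Finset.sum_div, ← Finset.mul_sum, ← Finset.sum_mul]
    rw [Finset.sum_comm (f := fun b a => p a b c), mul_div_assoc]
    set w := ∑ a, ∑ b, p a b c
    have : w * (w / w) ≤ w := mul_le_of_le_one_right
      (Finset.sum_nonneg fun a _ => Finset.sum_nonneg fun b _ => hp a b c) (div_self_le_one w)
    linarith
  rw [hinfo, Finset.mul_sum]
  refine le_trans (le_add_of_nonneg_left hzero) ?_
  rw [← Finset.sum_add_distrib]
  refine Finset.sum_le_sum fun c _ => ?_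
  rw [Finset.mul_sum, ← Finset.sum_add_distrib]
  refine Finset.sum_le_sum fun a _ => ?_
  rw [Finset.mul_sum, ← Finset.sum_add_distrib]
  refine Finset.sum_le_sum fun b _ => ?_
  exact mul_log_div_sub_log_div_ge (hp a b c)
    (Finset.single_le_sum (f := fun b' => p a b' c) (fun b' _ => hp a b' c) (Finset.mem_univ b))
    (Finset.single_le_sum (f := fun a' => p a' b c) (fun a' _ => hp a' b c) (Finset.mem_univ a))
    (Finset.single_le_sum (f := fun a' => ∑ b', p a' b' c)
      (fun a' _ => Finset.sum_nonneg fun b' _ => hp a' b' c) (Finset.mem_univ a)) hK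

/-! ### Estimates of the other player's probabilities. -/

/-- The other player's estimate of a player's probabilities, where `w x` is the weight of the
input `x`. -/
def estimate {X U : Type*} [Fintype X] (w : X → ℝ) (P : X → U → ℝ) (m : U) : ℝ :=
  (∑ x, w x * P x m) / ∑ x, w x

theorem estimate_nonneg {X U : Type*} [Fintype X] {w : X → ℝ} {P : X → U → ℝ}
    (hw : ∀ x, 0 ≤ w x) (hP : ∀ x m, 0 ≤ P x m) (m : U) : 0 ≤ estimate w P m :=
  div_nonneg (Finset.sum_nonneg fun x _ => mul_nonneg (hw x) (hP x m))
    (Finset.sum_nonneg fun x _ => hw x)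

/-- The identity `h` is averaged over `x`. Equality can fail because the estimate is `0` when all
the weights add up to `0`. -/
theorem sum_estimate_mul_le_one {X U : Type*} [Fintype X] [Fintype U] (w : X → ℝ) {P : X → U → ℝ}
    {q : U → ℝ} (h : ∀ x, ∑ m, P x m * q m = 1) : ∑ m, estimate w P m * q m ≤ 1 := by
  have : ∑ m, estimate w P m * q m = (∑ x, w x) / ∑ x, w x := by
    simp_rw [estimate, div_mul_eq_mul_div, ← Finset.sum_div, Finset.sum_mul]
    rw [Finset.sum_comm]
    congr 1
    refine Finset.sum_congr rfl fun x _ => ?_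
    simp_rw [mul_assoc, ← Finset.mul_sum, h, mul_one]
  rw [this]
  exact div_self_le_one _

/-- The probability that one player's estimate is too small by a factor `K` is bounded by the
information that the transcript reveals to that player. -/
theorem log_sub_one_mul_estimate_le {X Y U : Type*} [Fintype X] [Fintype Y] [Fintype U]
    {w : X → Y → ℝ} {P : X → U → ℝ} {Q : Y → U → ℝ} (hw : ∀ x y, 0 ≤ w x y)
    (hP : ∀ x m, 0 ≤ P x m) (hQ : ∀ y m, 0 ≤ Q y m) (h : ∀ x y, ∑ m, P x m * Q y m = 1)
    {K : ℝ} (hK : 0 < K) :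
    (Real.log K - 1) * ∑ y, ∑ x, w x y * ∑ m,
      (if K * estimate (fun x => w x y) P m < P x m then P x m * Q y m else 0) ≤
      condMutualInfo (fun m x y => w x y * (P x m * Q y m)) * Real.log 2 := by
  refine le_trans (le_of_eq ?_) (log_sub_one_mul_le_condMutualInfo
    (fun m x y => mul_nonneg (hw x y) (mul_nonneg (hP x m) (hQ y m))) hK)
  congr 1
  refine Finset.sum_congr rfl fun y _ => ?_
  rw [Finset.sum_comm (s := (Finset.univ : Finset U))]
  refine Finset.sum_congr rfl fun x _ => ?_
  rw [Finset.mul_sum]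
  refine Finset.sum_congr rfl fun m _ => ?_
  rw [Finset.sum_comm (s := (Finset.univ : Finset U))]
  simp_rw [← Finset.mul_sum, h, mul_one]
  rw [mul_ite, mul_zero]
  rcases (hw x y).eq_or_lt with h0 | h0
  · simp [← h0]
  rcases (hQ y m).eq_or_lt with h1 | h1
  · simp [← h1]
  have hs : 0 < ∑ x, w x y :=
    h0.trans_le (Finset.single_le_sum (f := fun x => w x y) (fun x _ => hw x y) (Finset.mem_univ x))
  refine if_congr ?_ rfl rfl
  -- The factor `Q y m` is common to the probabilities of `m` given `(x, y)` and given `y` alone. It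
  -- cancels from the information density, leaving the ratio of `P x m` to its estimate.
  have e1 : K * ((∑ x', w x' y * (P x' m * Q y m)) * w x y) =
      (K * ∑ x', w x' y * P x' m) * (w x y * Q y m) := by
    simp_rw [← mul_assoc, ← Finset.sum_mul]; ring
  have e2 : w x y * (P x m * Q y m) * ∑ x', w x' y =
      (P x m * ∑ x', w x' y) * (w x y * Q y m) := by ring
  rw [e1, e2, mul_lt_mul_iff_left₀ (mul_pos h0 h1), estimate, mul_div_assoc', div_lt_iff₀ hs]

/-! ### Messages and outputs of the players, measurable in the public coins. -/

theorem measurable_acceptTable_prod {P U : Type} [MeasurableSpace P] [MeasurableSpace U] {R N : ℕ}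
    {D : P → Set (Sample U)} (hD : MeasurableSet {c : P × Sample U | c.2 ∈ D c.1}) :
    Measurable fun c : P × (Fin R → Fin N → Sample U) => acceptTable (D c.1) c.2 := by
  refine measurable_pi_iff.2 fun j => measurable_pi_iff.2 fun i => measurable_to_bool ?_
  have : (fun c : P × (Fin R → Fin N → Sample U) => acceptTable (D c.1) c.2 j i) ⁻¹' {true} =
      (fun c => (c.1, c.2 j i)) ⁻¹' {c : P × Sample U | c.2 ∈ D c.1} := by
    ext c; simp [acceptTable]
  rw [this]
  exact hD.preimage (by fun_prop)

theorem measurableSet_acceptSet_prod {P U : Type} [MeasurableSpace P] [MeasurableSpace U]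
    [Countable U] [MeasurableSingletonClass U] {p q : P → U → ℝ}
    (hp : ∀ m, Measurable fun r => p r m) (hq : ∀ m, Measurable fun r => q r m) :
    MeasurableSet {c : P × Sample U | c.2 ∈ acceptSet (p c.1) (q c.1)} := by
  have hp' : Measurable fun c : P × U => p c.1 c.2 := measurable_from_prod_countable_left hp
  have hq' : Measurable fun c : P × U => q c.1 c.2 := measurable_from_prod_countable_left hq
  have hc : Measurable fun c : P × Sample U => (c.1, c.2.1) := by fun_prop
  have h1 : MeasurableSet {c : P × Sample U | (c.2.2.1 : ℝ) ≤ p c.1 c.2.1} :=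
    measurableSet_le (by fun_prop) (hp'.comp hc)
  have h2 : MeasurableSet {c : P × Sample U | (c.2.2.2 : ℝ) ≤ q c.1 c.2.1} :=
    measurableSet_le (by fun_prop) (hq'.comp hc)
  exact h1.inter h2

section

variable {P U : Type} [MeasurableSpace P] [MeasurableSpace U] {R N k : ℕ}

/-- The bits sent by a player who accepts the samples in `D r`. -/
def hashMessage (D : P → Set (Sample U)) (c : P × SampleSpace U R N k) (i : Fin R × Fin k) : Bool :=
  roundHashes (acceptTable (D c.1) c.2.1) c.2.2 i.1 i.2

/-- The output of a player who accepts the samples in `D r`, given the bits of the other player. -/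
def hashOutput [Inhabited U] (D : P → Set (Sample U))
    (t : (P × SampleSpace U R N k) × (Fin R × Fin k → Bool)) : U :=
  agreedLabel (acceptTable (D t.1.1) t.1.2.1) (fun j i => (t.1.2.1 j i).1) t.1.2.2
    fun j l => t.2 (j, l)

theorem measurable_hashMessage {D : P → Set (Sample U)}
    (hD : MeasurableSet {c : P × Sample U | c.2 ∈ D c.1}) :
    Measurable (hashMessage (R := R) (N := N) (k := k) D) := by
  have h1 : Measurable fun c : P × SampleSpace U R N k => (acceptTable (D c.1) c.2.1, c.2.2) :=
    ((measurable_acceptTable_prod hD).comp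
      (measurable_fst.prodMk (measurable_fst.comp measurable_snd))).prodMk
      (measurable_snd.comp measurable_snd)
  exact (measurable_of_finite fun (t : (Fin R → Fin N → Bool) × (Option (Fin N) → Fin k → Bool))
    (i : Fin R × Fin k) => roundHashes t.1 t.2 i.1 i.2).comp h1

theorem measurable_hashOutput [Inhabited U] [Finite U] [MeasurableSingletonClass U]
    {D : P → Set (Sample U)} (hD : MeasurableSet {c : P × Sample U | c.2 ∈ D c.1}) :
    Measurable (hashOutput (R := R) (N := N) (k := k) D) := by
  have h1 : Measurable fun c : P × SampleSpace U R N k => acceptTable (D c.1) c.2.1 :=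
    (measurable_acceptTable_prod hD).comp
      (measurable_fst.prodMk (measurable_fst.comp measurable_snd))
  have h2 : Measurable fun (c : P × SampleSpace U R N k) (j : Fin R) (i : Fin N) =>
      (c.2.1 j i).1 := by fun_prop
  have h3 : Measurable fun t : (P × SampleSpace U R N k) × (Fin R × Fin k → Bool) =>
      (acceptTable (D t.1.1) t.1.2.1, (fun j i => (t.1.2.1 j i).1), t.1.2.2, t.2) :=
    (h1.comp measurable_fst).prodMk ((h2.comp measurable_fst).prodMk
      ((measurable_snd.comp (measurable_snd.comp measurable_fst)).prodMk measurable_snd))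
  have h4 : Measurable fun t : (Fin R → Fin N → Bool) × (Fin R → Fin N → U) ×
      (Option (Fin N) → Fin k → Bool) × (Fin R × Fin k → Bool) =>
      agreedLabel t.1 t.2.1 t.2.2.1 fun j l => t.2.2.2 (j, l) := measurable_of_finite _
  have h5 := h4.comp h3
  unfold hashOutput
  exact h5

end

/-! ### The simulating protocol and its error. -/

namespace Protocol

variable {X Y : Type*} [MeasurableSpace X] [MeasurableSpace Y]

section

variable (π : Protocol X Y) (μ : Measure (X × Y))

theorem jointPmf_eq (r : π.Pub) (m : π.Messages) (x : X) (y : Y) :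
    π.jointPmf μ r m x y = μ.real {(x, y)} * (π.aliceProb x r m * π.bobProb y r m) := by
  rw [jointPmf, real_messages_eq]

/-- Bob's estimate of Alice's probabilities. -/
def aliceEstimate [Fintype X] (y : Y) (r : π.Pub) : π.Messages → ℝ :=
  estimate (fun x => μ.real {(x, y)}) fun x => π.aliceProb x r

/-- Alice's estimate of Bob's probabilities. -/
def bobEstimate [Fintype Y] (x : X) (r : π.Pub) : π.Messages → ℝ :=
  estimate (fun y => μ.real {(x, y)}) fun y => π.bobProb y r

theorem measurable_aliceEstimate [Fintype X] (y : Y) (m : π.Messages) :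
    Measurable fun r => π.aliceEstimate μ y r m :=
  (Finset.measurable_sum _ fun x _ => (π.measurable_aliceProb x m).const_mul _).div_const _

theorem measurable_bobEstimate [Fintype Y] (x : X) (m : π.Messages) :
    Measurable fun r => π.bobEstimate μ x r m :=
  (Finset.measurable_sum _ fun y _ => (π.measurable_bobProb y m).const_mul _).div_const _

theorem aliceEstimate_nonneg [Fintype X] (y : Y) (r : π.Pub) (m : π.Messages) :
    0 ≤ π.aliceEstimate μ y r m :=
  estimate_nonneg (fun _ => measureReal_nonneg) (fun x => π.aliceProb_nonneg x r) m

theorem bobEstimate_nonneg [Fintype Y] (x : X) (r : π.Pub) (m : π.Messages) :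
    0 ≤ π.bobEstimate μ x r m :=
  estimate_nonneg (fun _ => measureReal_nonneg) (fun y => π.bobProb_nonneg y r) m

variable [Fintype X] [Fintype Y]

/-- The probability that a player's estimate of the other's probability of the transcript is too
small by a factor `K`. -/
def misestimateProb (K : ℝ) (x : X) (y : Y) (r : π.Pub) : ℝ :=
  ∑ m, (if K * π.aliceEstimate μ y r m < π.aliceProb x r m then
    π.aliceProb x r m * π.bobProb y r m else 0) +
  ∑ m, (if K * π.bobEstimate μ x r m < π.bobProb y r m then
    π.aliceProb x r m * π.bobProb y r m else 0)

theorem integrable_misestimateProb (K : ℝ) (x : X) (y : Y) :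
    Integrable (π.misestimateProb μ K x y) π.pubLaw := by
  have key : ∀ m (f g : π.Pub → ℝ), Measurable f → Measurable g →
      Integrable (fun r => if K * f r < g r then π.aliceProb x r m * π.bobProb y r m else 0)
        π.pubLaw := by
    intro m f g hf hg
    refine Integrable.of_bound (C := 1) (Measurable.ite (measurableSet_lt (hf.const_mul K) hg)
      ((π.measurable_aliceProb x m).mul (π.measurable_bobProb y m))
      measurable_const).aestronglyMeasurable (.of_forall fun r => ?_)
    have h0 := mul_nonneg (π.aliceProb_nonneg x r m) (π.bobProb_nonneg y r m)
    have h1 := mul_le_one₀ (π.aliceProb_le_one x r m) (π.bobProb_nonneg y r m)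
      (π.bobProb_le_one y r m)
    split_ifs
    · rwa [Real.norm_of_nonneg h0]
    · simp
  exact (integrable_finsetSum _ fun m _ => key m _ _ (π.measurable_aliceEstimate μ y m)
    (π.measurable_aliceProb x m)).add (integrable_finsetSum _ fun m _ => key m _ _
      (π.measurable_bobEstimate μ x m) (π.measurable_bobProb y m))

theorem integrable_infoCost [IsProbabilityMeasure μ] :
    Integrable (fun r => condMutualInfo (fun m x y => π.jointPmf μ r m x y) +
      condMutualInfo (fun m y x => π.jointPmf μ r m x y)) π.pubLaw := by
  have hm : ∀ m x y, Measurable fun r => π.jointPmf μ r m x y := fun m x y => by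
    simp_rw [jointPmf_eq]
    exact ((π.measurable_aliceProb x m).mul (π.measurable_bobProb y m)).const_mul _
  have h0 : ∀ r m x y, 0 ≤ π.jointPmf μ r m x y := fun r m x y =>
    mul_nonneg measureReal_nonneg measureReal_nonneg
  have h1 : ∀ r m x y, π.jointPmf μ r m x y ≤ 1 := fun r m x y =>
    mul_le_one₀ measureReal_le_one measureReal_nonneg measureReal_le_one
  exact (integrable_condMutualInfo _ hm h0 h1).add (integrable_condMutualInfo _
    (fun m y x => hm m x y) (fun r m y x => h0 r m x y) fun r m y x => h1 r m x y)

theorem log_sub_one_mul_misestimateProb_le {K : ℝ} (hK : 0 < K) (r : π.Pub) :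
    (Real.log K - 1) * ∑ z : X × Y, μ.real {z} * π.misestimateProb μ K z.1 z.2 r ≤
      (condMutualInfo (fun m x y => π.jointPmf μ r m x y) +
        condMutualInfo (fun m y x => π.jointPmf μ r m x y)) * Real.log 2 := by
  have h1 := log_sub_one_mul_estimate_le (w := fun x y => μ.real {(x, y)})
    (fun x y => measureReal_nonneg) (fun x => π.aliceProb_nonneg x r)
    (fun y => π.bobProb_nonneg y r) (fun x y => π.sum_aliceProb_mul_bobProb x y r) hK
  have h2 := log_sub_one_mul_estimate_le (w := fun y x => μ.real {(x, y)})
    (fun y x => measureReal_nonneg) (fun y => π.bobProb_nonneg y r)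
    (fun x => π.aliceProb_nonneg x r)
    (fun y x => by simp_rw [mul_comm]; exact π.sum_aliceProb_mul_bobProb x y r) hK
  simp_rw [mul_comm (π.bobProb _ r _)] at h2
  simp_rw [jointPmf_eq, add_mul]
  refine le_trans (le_of_eq ?_) (add_le_add h1 h2)
  simp_rw [misestimateProb, mul_add, Finset.sum_add_distrib, mul_add]
  rw [Fintype.sum_prod_type_right, Fintype.sum_prod_type]
  rfl

theorem infoCost_nonneg : 0 ≤ π.infoCost μ := by
  refine integral_nonneg fun r => ?_
  -- At `K = exp 1` the factor `log K - 1` vanishes, and the bound reduces to nonnegativity of the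
  -- information.
  have := π.log_sub_one_mul_misestimateProb_le μ (Real.exp_pos 1) r
  rw [Real.log_exp, sub_self, zero_mul] at this
  exact nonneg_of_mul_nonneg_left this (Real.log_pos one_lt_two)

theorem log_sub_one_mul_integral_misestimateProb_le [IsProbabilityMeasure μ] {K : ℝ} (hK : 0 < K) :
    (Real.log K - 1) *
      ∑ z : X × Y, μ.real {z} * ∫ r, π.misestimateProb μ K z.1 z.2 r ∂π.pubLaw ≤
      π.infoCost μ * Real.log 2 := by
  have hint : ∀ z : X × Y, Integrable (fun r => μ.real {z} * π.misestimateProb μ K z.1 z.2 r)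
      π.pubLaw := fun z => (π.integrable_misestimateProb μ K z.1 z.2).const_mul _
  simp_rw [← integral_const_mul]
  rw [← integral_finsetSum _ fun z _ => hint z, ← integral_const_mul, infoCost,
    ← integral_mul_const]
  exact integral_mono ((integrable_finsetSum _ fun z _ => hint z).const_mul _)
    ((π.integrable_infoCost μ).mul_const _) fun r => π.log_sub_one_mul_misestimateProb_le μ hK r

end

variable [Fintype X] [Fintype Y] [MeasurableSingletonClass X] [MeasurableSingletonClass Y]

/-- The simulation with `R` rounds and hash values of `k` bits. -/
theorem exists_simulation (π : Protocol X Y) (μ : Measure (X × Y)) [IsProbabilityMeasure μ] {K : ℝ}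
    (hK : 1 ≤ K) (R k : ℕ) : ∃ τ : Protocol X Y, τ.length = R * k + R * k ∧ ∀ ε,
      2 * ∑ z : X × Y, μ.real {z} * ∫ r, π.misestimateProb μ K z.1 z.2 r ∂π.pubLaw +
        Real.exp (-(R / (3 * K))) + R * (2⁻¹ : ℝ) ^ k ≤ ε → τ.Simulates μ ε π := by
  -- Each player uses the own probability exactly and inflates the estimate of the other's by `K`.
  let DA : X → π.Pub → Set (Sample π.Messages) := fun x r =>
    acceptSet (π.aliceProb x r) fun m => K * π.bobEstimate μ x r m
  let DB : Y → π.Pub → Set (Sample π.Messages) := fun y r =>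
    acceptSet (fun m => K * π.aliceEstimate μ y r m) (π.bobProb y r)
  have hDA : ∀ x, MeasurableSet {c : π.Pub × Sample π.Messages | c.2 ∈ DA x c.1} := fun x =>
    measurableSet_acceptSet_prod (π.measurable_aliceProb x)
      fun m => (π.measurable_bobEstimate μ x m).const_mul K
  have hDB : ∀ y, MeasurableSet {c : π.Pub × Sample π.Messages | c.2 ∈ DB y c.1} := fun y =>
    measurableSet_acceptSet_prod (fun m => (π.measurable_aliceEstimate μ y m).const_mul K)
      (π.measurable_bobProb y)
  refine ⟨simultaneous (π.pubLaw.prod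
    (sampleSpaceLaw π.Messages R (Fintype.card π.Messages) k))
    (fun x => hashMessage (DA x)) (fun y => hashMessage (DB y))
    (fun x => measurable_hashMessage (hDA x)) (fun y => measurable_hashMessage (hDB y)),
    by simp [simultaneous], fun ε hε => ?_⟩
  set η : ℝ := Real.exp (-(R / (3 * K))) + R * (2⁻¹ : ℝ) ^ k with hη
  refine simulates_simultaneous π μ _ _ _ (oA := fun x => hashOutput (DA x))
    (oB := fun y => hashOutput (DB y)) (fun x => measurable_hashOutput (hDA x))
    (fun y => measurable_hashOutput (hDB y))
    (δ := fun x y r => 2 * π.misestimateProb μ K x y r + η)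
    (fun x y => ((π.integrable_misestimateProb μ K x y).const_mul 2).add (integrable_const _))
    ?_ fun x y r W => ?_
  · refine le_trans (le_of_eq ?_) hε
    have h1 : ∀ z : X × Y, μ.real {z} * ∫ r, (2 * π.misestimateProb μ K z.1 z.2 r + η) ∂π.pubLaw =
        2 * (μ.real {z} * ∫ r, π.misestimateProb μ K z.1 z.2 r ∂π.pubLaw) + μ.real {z} * η := by
      intro z
      rw [integral_add ((π.integrable_misestimateProb μ K z.1 z.2).const_mul 2)
        (integrable_const _), integral_const_mul]
      simp; ring
    rw [Finset.sum_congr rfl fun z _ => h1 z, Finset.sum_add_distrib, ← Finset.mul_sum,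
      ← Finset.sum_mul, sum_measureReal_singleton]
    simp [hη, add_assoc]
  · rw [real_messages_mem]
    have := sampleSpaceLaw_real_agree_acceptSet_ge hK (π.aliceProb_nonneg x r)
      (π.aliceProb_le_one x r) (π.bobProb_nonneg y r) (π.bobProb_le_one y r)
      (π.aliceEstimate_nonneg μ y r) (π.bobEstimate_nonneg μ x r)
      (π.sum_aliceProb_mul_bobProb x y r)
      (by
        simp_rw [mul_comm (π.aliceProb x r _)]
        exact sum_estimate_mul_le_one _ fun y => by
          simp_rw [mul_comm (π.bobProb y r _)]; exact π.sum_aliceProb_mul_bobProb x y r)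
      (sum_estimate_mul_le_one _ fun x => π.sum_aliceProb_mul_bobProb x y r)
      R k W (A := DA x r) (B := DB y r) rfl rfl
    rw [add_assoc, ← hη] at this
    exact this

end Protocol

/-! ### Choice of parameters and conclusion. -/

theorem two_le_logb_four_add {ε : ℝ} (hε : 0 < ε) : 2 ≤ Real.logb 2 (4 + 1 / ε) := by
  rw [Real.le_logb_iff_rpow_le one_lt_two (by positivity)]
  have : (0 : ℝ) < 1 / ε := by positivity
  norm_num
  linarith

theorem le_two_rpow {x : ℝ} (hx : 1 ≤ x) : x ≤ (2 : ℝ) ^ x := by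
  have := one_add_mul_self_le_rpow_one_add (s := 1) (by norm_num) hx
  norm_num at this
  linarith

theorem logb_two_le_self {x : ℝ} (hx : 1 ≤ x) : Real.logb 2 x ≤ x :=
  (Real.logb_le_iff_le_rpow one_lt_two (by linarith)).2 (le_two_rpow hx)

/-- The number of rounds and the length of the hash values. -/
theorem exists_rounds_and_bits {ε T : ℝ} (hε : 0 < ε) (hε1 : ε < 1) (hT : 1 ≤ T) :
    ∃ R k : ℕ, Real.exp (-(R / (3 * (4 * T)))) + R * (2⁻¹ : ℝ) ^ k ≤ ε / 2 ∧
      ((R * k + R * k : ℕ) : ℝ) ≤ Real.logb 2 (4 + 1 / ε) ^ 11 * T ^ 2 := by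
  set L := Real.logb 2 (4 + 1 / ε) with hL
  have hL2 : 2 ≤ L := two_le_logb_four_add hε
  have hlog2 : 0 < Real.log 2 := Real.log_pos one_lt_two
  have hlogε : Real.logb 2 (1 / ε) ≤ L :=
    Real.logb_le_logb_of_le one_lt_two (by positivity) (by linarith)
  have h1ε : 1 ≤ 1 / ε := (one_le_div hε).2 hε1.le
  -- the rounds
  have hln : Real.log (4 / ε) ≤ 2 * L := by
    have h1 : Real.log (4 / ε) ≤ Real.logb 2 (4 / ε) := by
      rw [Real.logb, le_div_iff₀ hlog2]
      have : 0 ≤ Real.log (4 / ε) := Real.log_nonneg (by rw [le_div_iff₀ hε]; linarith)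
      have := Real.log_two_lt_d9
      nlinarith
    have h2 : Real.logb 2 (4 / ε) = 2 + Real.logb 2 (1 / ε) := by
      rw [show 4 / ε = 2 ^ 2 * (1 / ε) by ring, Real.logb_mul (by norm_num) (by positivity),
        Real.logb_pow, Real.logb_self_eq_one one_lt_two]
      norm_num
    linarith
  have hln0 : 0 < Real.log (4 / ε) := Real.log_pos (by rw [lt_div_iff₀ hε]; linarith)
  -- With `K = 4 * T`, this is `3 * K * log (4 / ε)`, so the probability that all rounds fail
  -- contributes at most `ε / 4`.
  set R := ⌈12 * T * Real.log (4 / ε)⌉₊ with hR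
  have hR1 : 12 * T * Real.log (4 / ε) ≤ R := Nat.le_ceil _
  have hR0 : (0 : ℝ) < R := lt_of_lt_of_le (by positivity) hR1
  have hTL : 2 ≤ T * L := by nlinarith
  have hR2 : (R : ℝ) ≤ 25 * (T * L) := by
    have h1 : (R : ℝ) < 12 * T * Real.log (4 / ε) + 1 := Nat.ceil_lt_add_one (by positivity)
    have h2 : 12 * T * Real.log (4 / ε) ≤ 12 * T * (2 * L) := by gcongr
    linarith
  have hexp : Real.exp (-(R / (3 * (4 * T)))) ≤ ε / 4 := by
    have h1 : Real.log (4 / ε) ≤ R / (3 * (4 * T)) := by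
      rw [le_div_iff₀ (by positivity)]; linarith
    calc Real.exp (-(R / (3 * (4 * T)))) ≤ Real.exp (-Real.log (4 / ε)) :=
          Real.exp_le_exp.2 (neg_le_neg h1)
      _ = ε / 4 := by rw [Real.exp_neg, Real.exp_log (by positivity), inv_div]
  -- the hash values
  set k := ⌈Real.logb 2 (4 * R / ε)⌉₊ with hk
  -- The length `k` is chosen so that the union bound `R / 2 ^ k` for collisions is at most `ε / 4`.
  have hkpow : 4 * R / ε ≤ (2 : ℝ) ^ k := by
    rw [← Real.rpow_natCast, ← Real.logb_le_iff_le_rpow one_lt_two (by positivity)]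
    exact Nat.le_ceil _
  have hcoll : R * (2⁻¹ : ℝ) ^ k ≤ ε / 4 := by
    rw [inv_pow, ← div_eq_mul_inv, div_le_iff₀ (by positivity)]
    rw [div_le_iff₀ hε] at hkpow
    linarith
  have hk2 : (k : ℝ) ≤ 7 * (T * L) := by
    have h0 : 0 ≤ Real.logb 2 (4 * R / ε) := by
      refine Real.logb_nonneg one_lt_two ?_
      have : (1 : ℝ) ≤ R := by exact_mod_cast Nat.one_le_iff_ne_zero.2 (by
        intro h; rw [h] at hR0; simp at hR0)
      rw [le_div_iff₀ hε]; linarith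
    have h1 : (k : ℝ) < Real.logb 2 (4 * R / ε) + 1 := Nat.ceil_lt_add_one h0
    have h2 : 4 * R / ε ≤ 2 ^ 7 * (T * (L * (1 / ε))) := by
      calc 4 * R / ε ≤ 4 * (25 * (T * L)) / ε := by gcongr
        _ = 100 * (T * (L * (1 / ε))) := by ring
        _ ≤ 2 ^ 7 * (T * (L * (1 / ε))) := by gcongr; norm_num
    have h3 := Real.logb_le_logb_of_le one_lt_two (by positivity) h2
    rw [Real.logb_mul (by norm_num) (by positivity), Real.logb_mul (by positivity) (by positivity),
      Real.logb_mul (by positivity) (by positivity)] at h3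
    have h4 : Real.logb 2 ((2 : ℝ) ^ 7) = 7 := by
      rw [Real.logb_pow, Real.logb_self_eq_one one_lt_two]; norm_num
    have h5 := logb_two_le_self hT
    have h6 := logb_two_le_self (by linarith : 1 ≤ L)
    have h7 : T ≤ T * L := le_mul_of_one_le_right (by linarith) (by linarith)
    have h8 : L ≤ T * L := le_mul_of_one_le_left (by linarith) hT
    rw [h4] at h3
    linarith
  refine ⟨R, k, by linarith, ?_⟩
  push_cast
  have hk0 : (0 : ℝ) ≤ k := Nat.cast_nonneg k
  calc (R : ℝ) * k + R * k = 2 * (R * k) := by ring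
    _ ≤ 2 * (25 * (T * L) * (7 * (T * L))) := by gcongr
    _ = 350 * (L ^ 2 * T ^ 2) := by ring
    -- As `2 ≤ L`, nine powers of `L` absorb the constant `350`; this is where the exponent `11`
    -- comes from.
    _ ≤ L ^ 9 * (L ^ 2 * T ^ 2) := by
        gcongr
        calc (350 : ℝ) ≤ 2 ^ 9 := by norm_num
          _ ≤ L ^ 9 := by gcongr
    _ = L ^ 11 * T ^ 2 := by ring

/-- Polynomial factors are absorbed into the exponential if the information cost is at least `1`. -/
theorem logb_four_add_pow_mul_le {ε I : ℝ} (hε : 0 < ε) (hε1 : ε < 1) (hI : 1 ≤ I) :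
    Real.logb 2 (4 + 1 / ε) ^ 11 * ((2 : ℝ) ^ (4 * I / ε)) ^ 2 ≤ 2 ^ (100 * (I / ε)) := by
  set L := Real.logb 2 (4 + 1 / ε) with hL
  have hL2 : 2 ≤ L := two_le_logb_four_add hε
  have hIε : 1 / ε ≤ I / ε := by gcongr
  have h1ε : 1 ≤ 1 / ε := (one_le_div hε).2 hε1.le
  have hL5 : L ≤ 5 * (I / ε) := by
    have : L ≤ 4 + 1 / ε := logb_two_le_self (by linarith)
    linarith
  calc L ^ 11 * ((2 : ℝ) ^ (4 * I / ε)) ^ 2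
      ≤ ((2 : ℝ) ^ (5 * (I / ε))) ^ 11 * ((2 : ℝ) ^ (4 * I / ε)) ^ 2 := by
        gcongr
        exact (le_two_rpow (by linarith)).trans (Real.rpow_le_rpow_of_exponent_le one_le_two hL5)
    -- The exponent is `5 * 11 + 4 * 2`.
    _ = 2 ^ (63 * (I / ε)) := by
        rw [← Real.rpow_natCast, ← Real.rpow_natCast, ← Real.rpow_mul zero_le_two,
          ← Real.rpow_mul zero_le_two, ← Real.rpow_add zero_lt_two]
        congr 1
        push_cast
        ring
    _ ≤ 2 ^ (100 * (I / ε)) := by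
        refine Real.rpow_le_rpow_of_exponent_le one_le_two ?_
        linarith

/-- Every protocol is simulated with error `1` without communication. -/
theorem Protocol.exists_simulates_of_one_le {X Y : Type*} [Fintype X] [Fintype Y]
    [MeasurableSpace X] [MeasurableSpace Y] [MeasurableSingletonClass X]
    [MeasurableSingletonClass Y] (π : Protocol X Y) (μ : Measure (X × Y)) [IsProbabilityMeasure μ]
    {ε : ℝ} (hε : 1 ≤ ε) : ∃ τ : Protocol X Y, τ.length = 0 ∧ τ.Simulates μ ε π := by
  refine ⟨_, ?_, simulates_simultaneous (Ω := Unit) (ι := Empty) π μ (Measure.dirac ())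
    (fA := fun _ _ _ => false) (fB := fun _ _ _ => false) (fun _ => measurable_const)
    (fun _ => measurable_const) (oA := fun _ _ _ => false) (oB := fun _ _ _ => false)
    (fun _ => measurable_const) (fun _ => measurable_const) (δ := fun _ _ _ => 1)
    (fun _ _ => integrable_const _) ?_ fun x y r W => ?_⟩
  · simp [simultaneous]
  · simpa [sum_measureReal_singleton] using hε
  · exact (sub_nonpos.2 measureReal_le_one).trans measureReal_nonneg

end

theorem mainTheorem2 :
    ∃ C : ℝ, 0 < C ∧
      ∀ (X Y : Type*) [Fintype X] [Fintype Y]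
        [MeasurableSpace X] [MeasurableSpace Y]
        [MeasurableSingletonClass X] [MeasurableSingletonClass Y]
        (μ : Measure (X × Y)) [IsProbabilityMeasure μ]
        (π : Protocol X Y) (ε : ℝ), 0 < ε →
        ∃ τ : Protocol X Y, τ.Simulates μ ε π ∧
          (τ.length : ℝ) ≤
            Real.logb 2 (4 + 1 / ε) ^ C * (2 : ℝ) ^ (C * (π.infoCost μ / ε)) ∧
          (1 ≤ π.infoCost μ → (τ.length : ℝ) ≤ (2 : ℝ) ^ (C * (π.infoCost μ / ε))) := by
  refine ⟨100, by norm_num, fun X Y _ _ _ _ _ _ μ _ π ε hε => ?_⟩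
  have hL2 := two_le_logb_four_add hε
  set I := π.infoCost μ with hI
  have hI0 : 0 ≤ I := π.infoCost_nonneg μ
  -- For `K = 4 * 2 ^ t` one has `log K - 1 = (2 + t) * log 2 - 1 ≥ t * log 2`, as `2 * log 2 > 1`.
  -- Since `I = ε / 4 * t`, the misestimate probability is at most `ε / 4`. The factor `4` keeps
  -- `log K - 1` positive even if `I = 0`.
  set t := 4 * I / ε with ht
  have ht0 : 0 ≤ t := by positivity
  have hT : 1 ≤ (2 : ℝ) ^ t := Real.one_le_rpow one_le_two ht0
  have hK : 1 ≤ 4 * (2 : ℝ) ^ t := by linarith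
  -- the probability of a misestimate
  have hmis : 2 * ∑ z : X × Y, μ.real {z} *
      ∫ r, π.misestimateProb μ (4 * 2 ^ t) z.1 z.2 r ∂π.pubLaw ≤ ε / 2 := by
    have h1 := π.log_sub_one_mul_integral_misestimateProb_le μ (zero_lt_one.trans_le hK)
    have h2 : Real.log (4 * 2 ^ t) = (2 + t) * Real.log 2 := by
      rw [Real.log_mul (by norm_num) (by positivity), Real.log_rpow zero_lt_two,
        show (4 : ℝ) = 2 ^ 2 by norm_num, Real.log_pow]
      push_cast; ring
    have h3 : I = ε / 4 * t := by rw [ht]; field_simp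
    have hlog2 := Real.log_two_gt_d9
    have hpos : 0 < (2 + t) * Real.log 2 - 1 := by nlinarith
    rw [h2, ← hI, mul_comm] at h1
    have h4 : I * Real.log 2 ≤ ε / 4 * ((2 + t) * Real.log 2 - 1) := by
      rw [h3, mul_assoc]
      refine mul_le_mul_of_nonneg_left ?_ (by positivity)
      linarith
    have := le_of_mul_le_mul_right (h1.trans h4) hpos
    linarith
  rcases lt_or_ge ε 1 with hε1 | hε1
  · obtain ⟨R, k, hRk, hlen⟩ := exists_rounds_and_bits hε hε1 hT
    obtain ⟨τ, hτ, hsim⟩ := π.exists_simulation μ hK R k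
    refine ⟨τ, hsim ε (by linarith), ?_, fun h1 => ?_⟩
    · rw [hτ]
      -- The length is at most `L ^ 11 * 2 ^ (8 * I / ε)`, where `L = logb 2 (4 + 1 / ε)`; both
      -- exponents are below `C = 100`.
      refine hlen.trans (mul_le_mul ?_ ?_ (by positivity) (by positivity))
      · rw [← Real.rpow_natCast]
        exact Real.rpow_le_rpow_of_exponent_le (by linarith) (by norm_num)
      · rw [← Real.rpow_natCast, ← Real.rpow_mul zero_le_two, ht]
        refine Real.rpow_le_rpow_of_exponent_le one_le_two ?_
        have : 0 ≤ I / ε := by positivity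
        push_cast
        linarith [mul_div_assoc 4 I ε]
    · rw [hτ]
      exact hlen.trans (logb_four_add_pow_mul_le hε hε1 h1)
  · obtain ⟨τ, hτ, hsim⟩ := π.exists_simulates_of_one_le μ hε1
    refine ⟨τ, hsim, ?_, fun _ => ?_⟩
    · rw [hτ, Nat.cast_zero]
      have : 0 ≤ Real.logb 2 (4 + 1 / ε) := by linarith
      positivity
    · rw [hτ, Nat.cast_zero]
      positivity
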